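/- Let $m\ge 1$ and let $U\subset\mathbb R^m$ be open. Write $\mathcal M(U)$ for the finite signed Borel (Radon) measures on $U$, $\mathcal{DM}_\infty(U)=\{u\in L_\infty(U;\mathbb R^m):\operatorname{div}u\in\mathcal M(U)\}$ (distributional divergence), $\mathcal{DB}(U)$ for the closure of $\mathcal{DM}_\infty(U)$ in $L_\infty(U;\mathbb R^m)$, and $\mathcal M_{\operatorname{div}}(U)=\{\operatorname{div}u:u\in\mathcal{DM}_\infty(U)\}$. Let $\mathcal S(U)$ be the $\sigma$-algebra generated by the Suslin (analytic) subsets of $U$ and $\bar{\mathcal S}(U)$ its completion with respect to $\mathcal H^{m-1}$ on $U$. A bounded $\bar{\mathcal S}(U)$-measurable function $f:U\to\mathbb R$ has bounded fluctuation if $$\|f\|_{BF}=\sup\Big\{\int_U f\,\mathrm d\operatorname{div}u:\ u\in\mathcal{DM}_\infty(U),\ \|u\|_\infty\le1\Big\}<\infty .$$ Let $\mu_f\in\mathcal{DB}'(U)$ denote the unique continuous linear functional with $\langle\mu_f,u\rangle=-\int_U f\,\mathrm d\operatorname{div}u$ for all $u\in\mathcal{DM}_\infty(U)$ and $\|\mu_f\|=\|f\|_{BF}$.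 Let $E_f$ be the set of pairs $(\bar\mu_f,\bar f)$ where $\bar\mu_f\in L_\infty(U;\mathbb R^m)'$ extends $\mu_f$ with $\|\bar\mu_f\|=\|f\|_{BF}$, and $\bar f:U\to\mathbb R$ is an $\mathcal S(U)$-measurable function that agrees with $f$ outside an $\mathcal H^{m-1}$-null set and satisfies $\bar f(U)\subset f(U)$. **Theorem.** Let $a\le0\le b$ be real numbers, let $f:U\to[a,b]$ have bounded fluctuation, and let $(\bar\mu_f,\bar f)\in E_f$. Then the functional $\mu_f$ exists, and there is a net $(f_\alpha)$ in $C_0(U)$ with values in $[a,b]$ and distributional gradients $\nabla f_\alpha\in L_1(U;\mathbb R^m)$ with $\|\nabla f_\alpha\|_1\le\|f\|_{BF}$ for every $\alpha$, which may moreover be taken in $C_{\infty,c}(U;[a,b])$, such that 1. if $\|f\|_{BF}>0$ or $\bar f\equiv0$, then $f_\alpha\to\bar f$ weakly* in $\mathcal M'(U)$, that is, $\int_U f_\alpha\,\mathrm d\nu\to\int_U\bar f\,\mathrm d\nu$ for all $\nu\in\mathcal M(U)$; 2. $f_\alpha\to f$ weakly* in $\mathcal M_{\operatorname{div}}'(U)$,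 that is, $\int_U f_\alpha\,\mathrm d\nu\to\int_U f\,\mathrm d\nu$ for all $\nu\in\mathcal M_{\operatorname{div}}(U)$; 3. $\nabla f_\alpha\to\bar\mu_f$ weakly* in $L_\infty'(U;\mathbb R^m)$, that is, $\int_U\nabla f_\alpha\cdot u\,\mathrm dx\to\langle\bar\mu_f,u\rangle$ for all $u\in L_\infty(U;\mathbb R^m)$; 4. $\nabla f_\alpha\to\mu_f$ weakly* in $\mathcal{DB}'(U)$, that is, $\int_U\nabla f_\alpha\cdot u\,\mathrm dx\to\langle\mu_f,u\rangle$ for all $u\in\mathcal{DB}(U)$. -/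

import Mathlib

open MeasureTheory Filter Topology TopologicalSpace Set
open scoped ENNReal Distributions ZeroAtInfty

noncomputable section

namespace BoundedFluctuation

/-- Euclidean space `ℝ^m`. -/
abbrev Eu (m : ℕ) : Type := EuclideanSpace ℝ (Fin m)

/-- Lebesgue measure on the open set `U`. -/
abbrev leb {m : ℕ} (U : Opens (Eu m)) : Measure U := volume.comap Subtype.val

/-- `L_p(U; ℝ^m)` with respect to Lebesgue measure on the open set `U`. -/
abbrev LpField {m : ℕ} (U : Opens (Eu m)) (p : ℝ≥0∞) : Type :=
  Lp (Eu m) p (leb U)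

/-- `HasDiv u ν`: the distributional divergence of `u ∈ L_∞(U; ℝ^m)` is the finite signed Borel
(equivalently, Radon) measure `ν` on `U`. -/
def HasDiv {m : ℕ} {U : Opens (Eu m)} (u : LpField U ∞) (ν : SignedMeasure U) : Prop :=
  ∀ φ : 𝓓(U, ℝ), ∫ x : U, inner ℝ (u x) (gradient φ (x : Eu m)) ∂leb U = -∫ᵛ x, φ (x : Eu m) ∂•ν

lemma integrable_testFunction {m : ℕ} {U : Opens (Eu m)} (ν : SignedMeasure U) (φ : 𝓓(U, ℝ)) :
    ν.Integrable (fun x : U => φ (x : Eu m)) := by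
  have hfin : IsFiniteMeasure ν.variation := by
    rw [← SignedMeasure.totalVariation_eq_variation]
    infer_instance
  have hc : Continuous (fun x : U => φ (x : Eu m)) := φ.continuous.comp continuous_subtype_val
  obtain ⟨C, hC⟩ := φ.continuous.bounded_above_of_compact_support φ.hasCompactSupport
  exact Integrable.of_bound hc.aestronglyMeasurable C (ae_of_all _ fun x => hC x)

lemma integrable_inner_gradient {m : ℕ} {U : Opens (Eu m)} (u : LpField U ∞) (φ : 𝓓(U, ℝ)) :
    Integrable (fun x : U => inner ℝ (u x) (gradient φ (x : Eu m))) (leb U) := by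
  have hgc : Continuous (gradient (φ : Eu m → ℝ)) :=
    (InnerProductSpace.toDual ℝ (Eu m)).symm.continuous.comp
      (φ.contDiff.continuous_fderiv (by simp))
  have hgs : HasCompactSupport (gradient (φ : Eu m → ℝ)) :=
    (φ.hasCompactSupport.fderiv (𝕜 := ℝ)).comp_left (map_zero _)
  have hemb : MeasurableEmbedding (Subtype.val : U → Eu m) :=
    MeasurableEmbedding.subtype_coe U.isOpen.measurableSet
  have hmap : Measure.map Subtype.val (leb U) = volume.restrict (U : Set (Eu m)) :=
    map_comap_subtype_coe U.isOpen.measurableSet volume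
  have hg : Integrable (fun x : U => gradient φ (x : Eu m)) (leb U) := by
    refine (hemb.integrable_map_iff (g := gradient (φ : Eu m → ℝ))).1 ?_
    rw [hmap]
    exact (hgc.integrable_of_hasCompactSupport hgs).restrict
  have hu : ∀ᵐ x ∂leb U, ‖u x‖ ≤ ‖u‖ := by
    have hne : eLpNormEssSup u (leb U) ≠ ∞ := by
      rw [← eLpNorm_exponent_top]
      exact Lp.eLpNorm_ne_top u
    filter_upwards [ae_le_eLpNormEssSup (f := u) (μ := leb U)] with x hx
    rw [Lp.norm_def, eLpNorm_exponent_top, ← toReal_enorm]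
    exact ENNReal.toReal_mono hne hx
  refine Integrable.mono' (hg.norm.const_mul ‖u‖)
    ((Lp.aestronglyMeasurable u).inner hg.aestronglyMeasurable) ?_
  filter_upwards [hu] with x hx
  exact (norm_inner_le_norm _ _).trans (mul_le_mul_of_nonneg_right hx (norm_nonneg _))

lemma HasDiv.zero {m : ℕ} {U : Opens (Eu m)} : HasDiv (0 : LpField U ∞) 0 := by
  intro φ
  have h : (fun x : U => inner ℝ ((0 : LpField U ∞) x) (gradient φ (x : Eu m))) =ᵐ[leb U] 0 := by
    filter_upwards [Lp.coeFn_zero (Eu m) ∞ (leb U)] with x hx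
    rw [hx]
    simp
  rw [integral_congr_ae h]
  simp

lemma HasDiv.add {m : ℕ} {U : Opens (Eu m)} {u v : LpField U ∞} {μ ν : SignedMeasure U}
    (hu : HasDiv u μ) (hv : HasDiv v ν) : HasDiv (u + v) (μ + ν) := by
  intro φ
  have h : (fun x : U => inner ℝ ((u + v) x) (gradient φ (x : Eu m))) =ᵐ[leb U]
      fun x => inner ℝ (u x) (gradient φ (x : Eu m)) +
        inner ℝ (v x) (gradient φ (x : Eu m)) := by
    filter_upwards [Lp.coeFn_add u v] with x hx
    rw [hx, Pi.add_apply, inner_add_left]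
  rw [integral_congr_ae h, integral_add (integrable_inner_gradient u φ)
    (integrable_inner_gradient v φ), hu φ, hv φ,
    VectorMeasure.integral_add_vectorMeasure (integrable_testFunction μ φ)
      (integrable_testFunction ν φ)]
  ring

lemma HasDiv.smul {m : ℕ} {U : Opens (Eu m)} {u : LpField U ∞} {μ : SignedMeasure U}
    (c : ℝ) (hu : HasDiv u μ) : HasDiv (c • u) (c • μ) := by
  intro φ
  have h : (fun x : U => inner ℝ ((c • u) x) (gradient φ (x : Eu m))) =ᵐ[leb U]
      fun x => c * inner ℝ (u x) (gradient φ (x : Eu m)) := by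
    filter_upwards [Lp.coeFn_smul c u] with x hx
    rw [hx, Pi.smul_apply, real_inner_smul_left]
  rw [integral_congr_ae h, integral_const_mul, hu φ, VectorMeasure.integral_smul_vectorMeasure]
  simp

/-- `DM_∞(U)`: the bounded fields whose distributional divergence is a finite signed measure. -/
def DM {m : ℕ} (U : Opens (Eu m)) : Submodule ℝ (LpField U ∞) where
  carrier := {u | ∃ ν : SignedMeasure U, HasDiv u ν}
  zero_mem' := ⟨0, HasDiv.zero⟩
  add_mem' := fun ⟨μ, hμ⟩ ⟨ν, hν⟩ => ⟨μ + ν, hμ.add hν⟩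
  smul_mem' := fun c _ ⟨μ, hμ⟩ => ⟨c • μ, hμ.smul c⟩

/-- `DB(U)`: the closure of `DM_∞(U)` in the norm of `L_∞(U; ℝ^m)`. -/
def DB {m : ℕ} (U : Opens (Eu m)) : Submodule ℝ (LpField U ∞) := (DM U).topologicalClosure

lemma DM_le_DB {m : ℕ} (U : Opens (Eu m)) : DM U ≤ DB U := Submodule.le_topologicalClosure _

/-- `M_div(U)`: the finite signed measures that are divergences of bounded fields. -/
def Mdiv {m : ℕ} (U : Opens (Eu m)) : Set (SignedMeasure U) :=
  {ν | ∃ u : LpField U ∞, HasDiv u ν}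

/-- `S(U)`: the σ-algebra generated by the Suslin (analytic) subsets of `U`. -/
abbrev suslin {m : ℕ} (U : Opens (Eu m)) : MeasurableSpace U :=
  MeasurableSpace.generateFrom {s | AnalyticSet s}

/-- The completion of `S(U)` with respect to the `(m-1)`-dimensional Hausdorff measure on `U`: the
sets that agree with a member of `S(U)` up to an `H^{m-1}`-null set. -/
abbrev suslinCompletion {m : ℕ} (U : Opens (Eu m)) : MeasurableSpace U :=
  eventuallyMeasurableSpace (suslin U) (ae (μH[(m : ℝ) - 1] : Measure U))

/-- The bounded fluctuation seminorm `sup { ∫_U f d(div u) : u ∈ DM_∞(U), ‖u‖_∞ ≤ 1 }`, with values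
in `[0, ∞]`. (The field `u = 0` is admissible, so cutting off negative integrals at `0` does not
change the supremum.) -/
def bfNorm {m : ℕ} {U : Opens (Eu m)} (f : U → ℝ) : ℝ≥0∞ :=
  ⨆ (u : LpField U ∞) (ν : SignedMeasure U) (_ : HasDiv u ν) (_ : ‖u‖ ≤ 1),
    ENNReal.ofReal (∫ᵛ x, f x ∂•ν)

/-- `f ∈ BF_∞(U)`. -/
structure IsBF {m : ℕ} {U : Opens (Eu m)} (f : U → ℝ) : Prop where
  bounded : ∃ C : ℝ, ∀ x, |f x| ≤ C
  measurable : Measurable[suslinCompletion U] f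
  bfNorm_lt_top : bfNorm f < ∞

/-- `μ ∈ DB'(U)` represents the divergence integral of `f`:
`⟨μ, u⟩ = - ∫_U f d(div u)` for all `u ∈ DM_∞(U)`, and `‖μ‖ = ‖f‖_BF`. -/
def IsGaussFunctional {m : ℕ} {U : Opens (Eu m)} (f : U → ℝ) (μ : StrongDual ℝ (DB U)) : Prop :=
  (∀ (u : LpField U ∞) (ν : SignedMeasure U) (h : HasDiv u ν),
    μ ⟨u, DM_le_DB U ⟨ν, h⟩⟩ = -∫ᵛ x, f x ∂•ν) ∧ ‖μ‖ₑ = bfNorm f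

lemma IsGaussFunctional.unique {m : ℕ} {U : Opens (Eu m)} {f : U → ℝ} {μ₁ μ₂ : StrongDual ℝ (DB U)}
    (h₁ : IsGaussFunctional f μ₁) (h₂ : IsGaussFunctional f μ₂) : μ₁ = μ₂ := by
  ext ⟨w, hw⟩
  have hcl : ∀ w ∈ closure (DM U : Set (LpField U ∞)), ∀ hw : w ∈ DB U,
      μ₁ ⟨w, hw⟩ = μ₂ ⟨w, hw⟩ := by
    intro w hw hw'
    obtain ⟨s, hs, hlim⟩ := mem_closure_iff_seq_limit.1 hw
    have hlim' : Tendsto (fun n => (⟨s n, DM_le_DB U (hs n)⟩ : DB U)) atTop (𝓝 ⟨w, hw'⟩) :=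
      tendsto_subtype_rng.2 hlim
    refine tendsto_nhds_unique ((μ₁.continuous.tendsto _).comp hlim') ?_
    refine ((μ₂.continuous.tendsto _).comp hlim').congr fun n => ?_
    obtain ⟨ν, hν⟩ := hs n
    exact (h₂.1 _ ν hν).trans (h₁.1 _ ν hν).symm
  exact hcl w hw hw

open Classical in
/-- The functional `μ_f ∈ DB'(U)` of a bounded fluctuation function `f` (unique by
`IsGaussFunctional.unique`). -/
def gaussFunctional {m : ℕ} {U : Opens (Eu m)} (f : U → ℝ) : StrongDual ℝ (DB U) :=
  if h : ∃ μ : StrongDual ℝ (DB U), IsGaussFunctional f μ then h.choose else 0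

/-- `E_f`: the pairs `(μ̄, f̄)` of a norm preserving extension `μ̄ ∈ L_∞(U; ℝ^m)'` of `μ_f` and an
`S(U)`-measurable modification `f̄` of `f` on an `H^{m-1}`-null set whose range is no larger than
that of `f`. -/
def extensions {m : ℕ} {U : Opens (Eu m)} (f : U → ℝ) :
    Set (StrongDual ℝ (LpField U ∞) × (U → ℝ)) :=
  {p | (∀ u : DB U, p.1 u = gaussFunctional f u) ∧ ‖p.1‖ₑ = bfNorm f ∧
    Measurable[suslin U] p.2 ∧ p.2 =ᵐ[μH[(m : ℝ) - 1]] f ∧ range p.2 ⊆ range f}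

/-- `v ∈ L_1(U; ℝ^m)` is the distributional gradient of `w ∈ C_0(U)`. -/
def HasGrad {m : ℕ} {U : Opens (Eu m)} (w : C₀(U, ℝ)) (v : LpField U 1) : Prop :=
  ∀ φ : 𝓓(U, ℝ), ∫ x : U, w x • gradient φ (x : Eu m) ∂leb U = -∫ x : U, φ (x : Eu m) • v x ∂leb U

/-- The pairing of `v ∈ L_1(U; ℝ^m)` with `u ∈ L_∞(U; ℝ^m)`. -/
def pairing {m : ℕ} {U : Opens (Eu m)} (v : LpField U 1) (u : LpField U ∞) : ℝ :=
  ∫ x : U, inner ℝ (v x) (u x) ∂leb U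

end BoundedFluctuation

end

/-!
The integral of `f` against a divergence measure depends only on `f` up to `H^{m-1}`-null sets,
because divergence measures of bounded fields do not charge such sets: a compact `H^{m-1}`-null set
has zero `1`-capacity, so that the cutoff functions of
`exists_testFunction_of_hausdorffMeasure_eq_zero` have small gradients and concentrate near it
(`HasDiv.variation_absolutelyContinuous`). The representative `f̄` is measurable with respect to the
Suslin sets, hence universally measurable (`MeasureTheory.AnalyticSet.nullMeasurableSet`), and can
be integrated against every finite measure. The functional `μ_f` is then defined on the fields with
measure divergence, is bounded there by `‖f‖_BF`, and extends to the closure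
(`exists_isGaussFunctional`).

Put `M = ‖f‖_BF > 0`. The net comes from a bipolar argument for the pair `(f̄, μ̄)` in the dual of
the pairs `(ν, u)` of a signed measure and a bounded field. Fix `δ > 0` and let `K` consist of the
test functions `φ` with values in `[a - δ, b + δ]` and `‖∇φ‖₁ ≤ M`. If `∫ φ dν + ∫ ∇φ · u ≤ c` for
all `φ ∈ K`, then the Hahn–Banach theorem and the representation theorems for the duals of `C_c` and
`L_1` give finite measures `p`, `n` and a bounded field `w` with
`∫ φ dν + ∫ ∇φ · u = ∫ φ d(p - n) + ∫ ∇φ · w` for all test functions and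
`(b + δ) p(U) + (δ - a) n(U) + M ‖w‖ ≤ c` (`exists_dual_representation`). The identity says that
`div (u - w) = ν - (p - n)`; as `μ̄` extends `μ_f`, this yields
`∫ f̄ dν + μ̄(u) = ∫ f̄ d(p - n) + μ̄(w) ≤ c` (`integral_add_le_of_forall_testFunction`). Separation
in finite dimensions now shows that the elements of `K` approximate `(f̄, μ̄)` on any finite set of
pairs (`exists_testFunction_near`). Enlarging `[a, b]` makes both `b + δ` and `δ - a` positive, as
the Hahn–Banach step requires.

The exact range `[a, b]` is recovered by a smooth truncation `ψ` of `φ`. It is uniformly close to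
`φ`, and `‖∇ψ‖₁ + ‖∇(φ - ψ)‖₁ = ‖∇φ‖₁ ≤ M` because the truncation has slopes in `[0, 1]`
(`exists_truncated_testFunction`). Testing with a nearly optimal field in the definition of
`‖f‖_BF` shows that `‖∇ψ‖₁` is almost `M`, so that `∇(φ - ψ)` is small in `L_1`
(`exists_testFunction_near_of_mem_Icc`). The net is indexed by the finite sets of pairs and the
tolerances (`exists_net`). If `‖f‖_BF = 0`, then `μ_f` and `μ̄` vanish and the constant net `0`
serves; convergence to `f̄` is then claimed for `f̄ = 0` only.
-/

noncomputable section

open scoped CompactlySupported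

namespace BoundedFluctuation

/-! ### Universal measurability of analytic sets -/

lemma isCompact_box (N : ℕ → ℕ) : IsCompact {x : ℕ → ℕ | ∀ i, x i ≤ N i} := by
  convert isCompact_univ_pi (s := fun i => Iic (N i)) (fun i => (finite_Iic (N i)).isCompact)
    using 1
  ext y
  simp [Pi.le_def]

/-- An open neighbourhood of the compact box `{x | ∀ i, x i ≤ N i}` of the Baire space contains one
of the cylinders `{x | ∀ i < k, x i ≤ N i}`. -/
lemma exists_cylinder_subset_of_box_subset {N : ℕ → ℕ} {W : Set (ℕ → ℕ)} (hW : IsOpen W)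
    (hNW : {x : ℕ → ℕ | ∀ i, x i ≤ N i} ⊆ W) :
    ∃ k, {x : ℕ → ℕ | ∀ i < k, x i ≤ N i} ⊆ W := by
  by_contra! h
  have h' : ∀ k, ∃ x : ℕ → ℕ, (∀ i < k, x i ≤ N i) ∧ x ∉ W := fun k => by
    obtain ⟨x, hx, hxW⟩ := not_subset.1 (h k)
    exact ⟨x, hx, hxW⟩
  choose x hx hxW using h'
  have hK := isCompact_box N
  obtain ⟨y, hy, φ, hφ, hlim⟩ := hK.tendsto_subseq (x := fun k i => min (x k i) (N i))
    (fun k i => min_le_right _ _)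
  -- the truncated points `min (x k) N` and the points `x k` agree in the first `k` coordinates
  have hlim' : Tendsto (fun k => x (φ k)) atTop (𝓝 y) := by
    rw [tendsto_pi_nhds] at hlim ⊢
    intro i
    refine (hlim i).congr' ?_
    filter_upwards [eventually_gt_atTop i] with k hk
    exact min_eq_left (hx _ _ (hk.trans_le (hφ.id_le k)))
  exact hW.isClosed_compl.mem_of_tendsto hlim' (Eventually.of_forall fun k => hxW _) (hNW hy)

/-- Choquet capacitability for finite Borel measures: an analytic set is approximated in measure by
its compact subsets. For a continuous image of the Baire space, bounding one coordinate after the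
other loses no more measure than the strict inequality `c < μ s` allows, and bounding all of them
leaves the image of a compact box. -/
lemma _root_.MeasureTheory.AnalyticSet.exists_isCompact_le {α : Type*} [TopologicalSpace α]
    [MeasurableSpace α] (μ : Measure α) [μ.OuterRegular] {s : Set α} (hs : AnalyticSet s)
    {c : ℝ≥0∞} (hc : c < μ s) : ∃ K ⊆ s, IsCompact K ∧ c ≤ μ K := by
  rw [AnalyticSet] at hs
  obtain rfl | ⟨f, hf, rfl⟩ := hs
  · simp at hc
  have hstep : ∀ (k : ℕ) (D : {D : Set (ℕ → ℕ) // c < μ (f '' D)}),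
      ∃ n : ℕ, c < μ (f '' (D.1 ∩ {x | x k ≤ n})) := by
    intro k D
    have hU : f '' D.1 = ⋃ n : ℕ, f '' (D.1 ∩ {x | x k ≤ n}) := by
      rw [← image_iUnion, ← inter_iUnion]
      congr 1
      refine (inter_eq_left.2 fun x _ => mem_iUnion.2 ⟨x k, mem_ofPred.2 le_rfl⟩).symm
    have hm : Monotone fun n : ℕ => f '' (D.1 ∩ {x | x k ≤ n}) := fun a b hab =>
      image_mono (inter_subset_inter_right _ fun x (hx : x k ≤ a) => hx.trans hab)
    have := D.2
    rw [hU, hm.measure_iUnion, lt_iSup_iff] at this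
    exact this
  choose n hn using hstep
  let D : ℕ → {D : Set (ℕ → ℕ) // c < μ (f '' D)} := fun k =>
    Nat.rec ⟨univ, by simpa using hc⟩ (fun k D => ⟨D.1 ∩ {x | x k ≤ n k D}, hn k D⟩) k
  let N : ℕ → ℕ := fun k => n k (D k)
  have hD : ∀ k, (D k).1 = {x | ∀ i < k, x i ≤ N i} := by
    intro k
    induction k with
    | zero => ext; simp [D]
    | succ k ih =>
      have : (D (k + 1)).1 = (D k).1 ∩ {x | x k ≤ N k} := rfl
      rw [this, ih]
      ext x
      simp only [mem_inter_iff, mem_ofPred_eq, Nat.lt_succ_iff_lt_or_eq, or_imp, forall_and,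
        forall_eq]
  have hK := isCompact_box N
  refine ⟨f '' {x : ℕ → ℕ | ∀ i, x i ≤ N i}, image_subset_range _ _, hK.image hf, ?_⟩
  rw [Set.measure_eq_iInf_isOpen]
  refine le_iInf₂ fun V hKV => le_iInf fun hV => ?_
  obtain ⟨k, hk⟩ := exists_cylinder_subset_of_box_subset (hV.preimage hf) (image_subset_iff.1 hKV)
  rw [← hD] at hk
  exact (D k).2.le.trans (measure_mono (image_subset_iff.2 hk))

lemma _root_.MeasureTheory.AnalyticSet.nullMeasurableSet {α : Type*} [TopologicalSpace α]
    [T2Space α] [MeasurableSpace α] [BorelSpace α] (μ : Measure α) [IsFiniteMeasure μ]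
    [μ.OuterRegular] {s : Set α} (hs : AnalyticSet s) : NullMeasurableSet s μ := by
  obtain h0 | h0 := eq_or_ne (μ s) 0
  · exact NullMeasurableSet.of_null h0
  have hlt : ∀ n : ℕ, μ s - ((n : ℝ≥0∞) + 1)⁻¹ < μ s := fun n =>
    ENNReal.sub_lt_self (measure_ne_top _ _) h0 (by simp)
  choose K hKs hKc hK using fun n => hs.exists_isCompact_le μ (hlt n)
  have hmeas : MeasurableSet (⋃ n, K n) := MeasurableSet.iUnion fun n => (hKc n).measurableSet
  have hsub : (⋃ n, K n) ⊆ s := iUnion_subset hKs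
  have hle : μ s ≤ μ (⋃ n, K n) := by
    refine ENNReal.le_of_forall_pos_le_add fun ε hε _ => ?_
    obtain ⟨n, hn⟩ := ENNReal.exists_inv_nat_lt (ENNReal.coe_ne_zero.2 hε.ne')
    calc μ s ≤ μ (K n) + ((n : ℝ≥0∞) + 1)⁻¹ := tsub_le_iff_right.1 (hK n)
      _ ≤ μ (⋃ n, K n) + ε := by
        gcongr
        · exact subset_iUnion K n
        · exact (ENNReal.inv_le_inv.2 le_self_add).trans hn.le
  exact ⟨⋃ n, K n, hmeas, (ae_eq_of_subset_of_measure_ge hsub hle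
    hmeas.nullMeasurableSet (measure_ne_top _ _)).symm⟩

/-- Functions measurable with respect to the Suslin sets are universally measurable. -/
lemma aestronglyMeasurable_of_measurable_suslin {m : ℕ} {U : Opens (Eu m)} {g : U → ℝ}
    (hg : Measurable[suslin U] g) (μ : Measure U) [IsFiniteMeasure μ] :
    AEStronglyMeasurable g μ := by
  have hle : suslin U ≤ (inferInstance : MeasurableSpace (NullMeasurableSpace U μ)) :=
    MeasurableSpace.generateFrom_le fun s hs => AnalyticSet.nullMeasurableSet μ hs
  have : NullMeasurable g μ := fun s hs => hle _ (hg hs)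
  exact this.aemeasurable.aestronglyMeasurable

/-! ### Test functions and their gradients -/

section TestFunctions

variable {m : ℕ} {U : Opens (Eu m)}

lemma gradient_continuous (φ : 𝓓(U, ℝ)) : Continuous (gradient (φ : Eu m → ℝ)) :=
  (InnerProductSpace.toDual ℝ (Eu m)).symm.continuous.comp
    (φ.contDiff.continuous_fderiv (by simp))

lemma gradient_hasCompactSupport (φ : 𝓓(U, ℝ)) :
    HasCompactSupport (gradient (φ : Eu m → ℝ)) :=
  (φ.hasCompactSupport.fderiv (𝕜 := ℝ)).comp_left (map_zero _)

lemma testFunction_differentiable (φ : 𝓓(U, ℝ)) : Differentiable ℝ (φ : Eu m → ℝ) :=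
  φ.contDiff.differentiable (by simp)

lemma testFunction_hasGradientAt (φ : 𝓓(U, ℝ)) (x : Eu m) :
    HasGradientAt φ (gradient φ x) x :=
  (testFunction_differentiable φ x).hasGradientAt

lemma gradient_testFunction_add (φ ψ : 𝓓(U, ℝ)) (x : Eu m) :
    gradient (φ + ψ : 𝓓(U, ℝ)) x = gradient φ x + gradient ψ x := by
  refine HasGradientAt.gradient ?_
  rw [hasGradientAt_iff_hasFDerivAt, map_add]
  exact (testFunction_hasGradientAt φ x).hasFDerivAt.add
    (testFunction_hasGradientAt ψ x).hasFDerivAt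

lemma gradient_testFunction_smul (c : ℝ) (φ : 𝓓(U, ℝ)) (x : Eu m) :
    gradient (c • φ : 𝓓(U, ℝ)) x = c • gradient φ x := by
  refine HasGradientAt.gradient ?_
  rw [hasGradientAt_iff_hasFDerivAt, map_smulₛₗ]
  exact (testFunction_hasGradientAt φ x).hasFDerivAt.const_smul c

lemma integrable_leb_of_hasCompactSupport {E : Type*} [NormedAddCommGroup E] {g : Eu m → E}
    (hg : Continuous g) (hs : HasCompactSupport g) :
    Integrable (fun x : U => g x) (leb U) := by
  have hemb : MeasurableEmbedding (Subtype.val : U → Eu m) :=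
    MeasurableEmbedding.subtype_coe U.isOpen.measurableSet
  have hmap : Measure.map Subtype.val (leb U) = volume.restrict (U : Set (Eu m)) :=
    map_comap_subtype_coe U.isOpen.measurableSet volume
  refine (hemb.integrable_map_iff (g := g)).1 ?_
  rw [hmap]
  exact (hg.integrable_of_hasCompactSupport hs).restrict

lemma integrable_gradient (φ : 𝓓(U, ℝ)) :
    Integrable (fun x : U => gradient φ (x : Eu m)) (leb U) :=
  integrable_leb_of_hasCompactSupport (gradient_continuous φ) (gradient_hasCompactSupport φ)

/-- The gradient of a test function, as an element of `L_1(U; ℝ^m)`. -/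
def gradLp : 𝓓(U, ℝ) →ₗ[ℝ] LpField U 1 where
  toFun φ := (integrable_gradient φ).toL1 _
  map_add' φ ψ := by
    rw [← Integrable.toL1_add]
    congr 1
    ext1 x
    exact gradient_testFunction_add φ ψ x
  map_smul' c φ := by
    rw [RingHom.id_apply, ← Integrable.toL1_smul]
    congr 1
    ext1 x
    exact gradient_testFunction_smul c φ x

lemma coeFn_gradLp (φ : 𝓓(U, ℝ)) :
    gradLp φ =ᵐ[leb U] fun x : U => gradient φ (x : Eu m) :=
  (integrable_gradient φ).coeFn_toL1

lemma norm_gradLp (φ : 𝓓(U, ℝ)) : ‖gradLp φ‖ = ∫ x : U, ‖gradient φ (x : Eu m)‖ ∂leb U := by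
  rw [L1.norm_eq_integral_norm]
  refine integral_congr_ae ?_
  filter_upwards [coeFn_gradLp φ] with x hx
  rw [hx]

lemma hasCompactSupport_restrict (φ : 𝓓(U, ℝ)) :
    HasCompactSupport (fun x : U => φ (x : Eu m)) := by
  refine HasCompactSupport.intro (K := Subtype.val ⁻¹' tsupport φ) ?_ ?_
  · have h : Subtype.val '' (Subtype.val ⁻¹' tsupport φ : Set U) = tsupport φ :=
      (Subtype.image_preimage_coe (U : Set (Eu m)) _).trans (inter_eq_right.2 φ.tsupport_subset)
    rw [Subtype.isCompact_iff, h]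
    exact φ.hasCompactSupport
  · intro x hx
    exact image_eq_zero_of_notMem_tsupport hx

/-- A test function, as a compactly supported continuous function on `U`. -/
def testCc : 𝓓(U, ℝ) →ₗ[ℝ] C_c(U, ℝ) where
  toFun φ := ⟨⟨fun x => φ (x : Eu m), φ.continuous.comp continuous_subtype_val⟩,
    hasCompactSupport_restrict φ⟩
  map_add' _ _ := rfl
  map_smul' _ _ := rfl

@[simp] lemma testCc_apply (φ : 𝓓(U, ℝ)) (x : U) : testCc φ x = φ (x : Eu m) := rfl

lemma testCc_injective : Function.Injective (testCc : 𝓓(U, ℝ) →ₗ[ℝ] C_c(U, ℝ)) := by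
  intro φ ψ h
  ext x
  by_cases hx : x ∈ U
  · exact DFunLike.congr_fun h ⟨x, hx⟩
  · rw [image_eq_zero_of_notMem_tsupport fun h => hx (φ.tsupport_subset h),
      image_eq_zero_of_notMem_tsupport fun h => hx (ψ.tsupport_subset h)]

/-- A test function, as an element of `C_0(U)`. -/
def testC0 (φ : 𝓓(U, ℝ)) : C₀(U, ℝ) where
  toFun x := φ (x : Eu m)
  continuous_toFun := φ.continuous.comp continuous_subtype_val
  zero_at_infty' := (hasCompactSupport_restrict φ).is_zero_at_infty

@[simp] lemma testC0_apply (φ : 𝓓(U, ℝ)) (x : U) : testC0 φ x = φ (x : Eu m) := rfl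

lemma integral_leb_eq {E : Type*} [NormedAddCommGroup E] [NormedSpace ℝ E] {g : Eu m → E}
    (h : ∀ x ∉ U, g x = 0) : ∫ x : U, g x ∂leb U = ∫ x, g x := by
  refine (integral_subtype_comap U.isOpen.measurableSet g).trans ?_
  exact setIntegral_eq_integral_of_forall_compl_eq_zero h

lemma testFunction_eq_zero (φ : 𝓓(U, ℝ)) {x : Eu m} (hx : x ∉ U) : φ x = 0 :=
  image_eq_zero_of_notMem_tsupport fun h => hx (φ.tsupport_subset h)

lemma inner_gradient (φ : 𝓓(U, ℝ)) (x e : Eu m) :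
    inner ℝ e (gradient φ x) = fderiv ℝ φ x e := by
  rw [real_inner_comm, gradient, InnerProductSpace.toDual_symm_apply]

lemma hasGrad_testC0 (φ : 𝓓(U, ℝ)) : HasGrad (testC0 φ) (gradLp φ) := by
  intro ψ
  have h1 : ∫ x : U, ψ (x : Eu m) • gradLp φ x ∂leb U =
      ∫ x : U, ψ (x : Eu m) • gradient φ (x : Eu m) ∂leb U := by
    refine integral_congr_ae ?_
    filter_upwards [coeFn_gradLp φ] with x hx
    rw [hx]
  have i1 : Integrable fun x => φ x • gradient ψ x :=
    (φ.continuous.smul (gradient_continuous ψ)).integrable_of_hasCompactSupport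
      φ.hasCompactSupport.smul_right
  have i2 : Integrable fun x => ψ x • gradient φ x :=
    (ψ.continuous.smul (gradient_continuous φ)).integrable_of_hasCompactSupport
      ψ.hasCompactSupport.smul_right
  rw [h1]
  simp only [testC0_apply]
  rw [integral_leb_eq (g := fun x => φ x • gradient ψ x)
      (fun x hx => by simp [testFunction_eq_zero φ hx]),
    integral_leb_eq (g := fun x => ψ x • gradient φ x)
      (fun x hx => by simp [testFunction_eq_zero ψ hx])]
  refine ext_inner_left ℝ fun e => ?_
  have hd : ∀ χ : 𝓓(U, ℝ), Continuous fun x => fderiv ℝ χ x e := fun χ =>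
    (χ.contDiff.continuous_fderiv (by simp)).clm_apply continuous_const
  rw [inner_neg_right, ← integral_inner i1, ← integral_inner i2]
  simp only [inner_smul_right, inner_gradient]
  rw [integral_mul_fderiv_eq_neg_fderiv_mul_of_integrable]
  · simp only [mul_comm]
  · exact ((hd φ).mul ψ.continuous).integrable_of_hasCompactSupport
      ψ.hasCompactSupport.mul_left
  · exact (φ.continuous.mul (hd ψ)).integrable_of_hasCompactSupport
      φ.hasCompactSupport.mul_right
  · exact (φ.continuous.mul ψ.continuous).integrable_of_hasCompactSupport
      φ.hasCompactSupport.mul_right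
  · exact fun x _ => testFunction_differentiable φ x
  · exact fun x _ => testFunction_differentiable ψ x

end TestFunctions

/-! ### The pairing of `L_1` and `L_∞` -/

section Pairing

variable {m : ℕ} {U : Opens (Eu m)}

lemma ae_norm_le_norm (u : LpField U ∞) : ∀ᵐ x ∂leb U, ‖u x‖ ≤ ‖u‖ := by
  have hne : eLpNormEssSup u (leb U) ≠ ∞ := by
    rw [← eLpNorm_exponent_top]
    exact Lp.eLpNorm_ne_top u
  filter_upwards [ae_le_eLpNormEssSup (f := u) (μ := leb U)] with x hx
  rw [Lp.norm_def, eLpNorm_exponent_top, ← toReal_enorm]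
  exact ENNReal.toReal_mono hne hx

lemma integrable_pairing (v : LpField U 1) (u : LpField U ∞) :
    Integrable (fun x : U => inner ℝ (v x) (u x)) (leb U) := by
  have hv := L1.integrable_coeFn v
  refine Integrable.mono' (hv.norm.mul_const ‖u‖)
    (hv.aestronglyMeasurable.inner (Lp.aestronglyMeasurable u)) ?_
  filter_upwards [ae_norm_le_norm u] with x hx
  exact (norm_inner_le_norm _ _).trans (mul_le_mul_of_nonneg_left hx (norm_nonneg _))

lemma abs_pairing_le (v : LpField U 1) (u : LpField U ∞) : |pairing v u| ≤ ‖v‖ * ‖u‖ := by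
  rw [L1.norm_eq_integral_norm, ← integral_mul_const]
  refine norm_integral_le_of_norm_le (f := fun x => inner ℝ (v x) (u x))
    ((L1.integrable_coeFn v).norm.mul_const _) ?_
  filter_upwards [ae_norm_le_norm u] with x hx
  exact (norm_inner_le_norm _ _).trans (mul_le_mul_of_nonneg_left hx (norm_nonneg _))

lemma pairing_add_left (v w : LpField U 1) (u : LpField U ∞) :
    pairing (v + w) u = pairing v u + pairing w u := by
  rw [pairing, pairing, pairing, ← integral_add (integrable_pairing v u) (integrable_pairing w u)]
  refine integral_congr_ae ?_
  filter_upwards [Lp.coeFn_add v w] with x hx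
  rw [hx, Pi.add_apply, inner_add_left]

lemma pairing_smul_left (c : ℝ) (v : LpField U 1) (u : LpField U ∞) :
    pairing (c • v) u = c * pairing v u := by
  rw [pairing, pairing, ← integral_const_mul]
  refine integral_congr_ae ?_
  filter_upwards [Lp.coeFn_smul c v] with x hx
  rw [hx, Pi.smul_apply, real_inner_smul_left]

lemma pairing_add_right (v : LpField U 1) (u w : LpField U ∞) :
    pairing v (u + w) = pairing v u + pairing v w := by
  rw [pairing, pairing, pairing, ← integral_add (integrable_pairing v u) (integrable_pairing v w)]
  refine integral_congr_ae ?_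
  filter_upwards [Lp.coeFn_add u w] with x hx
  rw [hx, Pi.add_apply, inner_add_right]

lemma pairing_smul_right (c : ℝ) (v : LpField U 1) (u : LpField U ∞) :
    pairing v (c • u) = c * pairing v u := by
  rw [pairing, pairing, ← integral_const_mul]
  refine integral_congr_ae ?_
  filter_upwards [Lp.coeFn_smul c u] with x hx
  rw [hx, Pi.smul_apply, real_inner_smul_right]

variable (U) in
/-- The pairing of `L_1(U; ℝ^m)` and `L_∞(U; ℝ^m)`, as a bilinear map. -/
def pairingₗ : LpField U 1 →ₗ[ℝ] LpField U ∞ →ₗ[ℝ] ℝ :=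
  LinearMap.mk₂ ℝ pairing pairing_add_left pairing_smul_left pairing_add_right pairing_smul_right

lemma pairing_gradLp (φ : 𝓓(U, ℝ)) (u : LpField U ∞) :
    pairing (gradLp φ) u = ∫ x : U, inner ℝ (u x) (gradient φ (x : Eu m)) ∂leb U := by
  refine integral_congr_ae ?_
  filter_upwards [coeFn_gradLp φ] with x hx
  rw [hx, real_inner_comm]

lemma hasDiv_iff_pairing {u : LpField U ∞} {ν : SignedMeasure U} :
    HasDiv u ν ↔ ∀ φ : 𝓓(U, ℝ), pairing (gradLp φ) u = -∫ᵛ x, φ (x : Eu m) ∂•ν := by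
  simp only [pairing_gradLp]
  rfl

end Pairing

/-! ### Integration against signed measures -/

section SignedMeasure

variable {X : Type*} [MeasurableSpace X]

instance isFiniteMeasure_variation (ν : SignedMeasure X) : IsFiniteMeasure ν.variation := by
  rw [← SignedMeasure.totalVariation_eq_variation]
  infer_instance

lemma abs_integral_signedMeasure_le (ν : SignedMeasure X) {g : X → ℝ} {C : ℝ}
    (hg : ∀ x, |g x| ≤ C) : |∫ᵛ x, g x ∂•ν| ≤ C * ν.variation.real univ := by
  have hC : ∀ᵐ x ∂ν.variation, ‖g x‖ ≤ C := ae_of_all _ hg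
  refine (VectorMeasure.norm_integral_le_of_norm_le_const
    (B := ContinuousLinearMap.lsmul ℝ ℝ) hC).trans ?_
  rcases isEmpty_or_nonempty X with h | ⟨⟨x⟩⟩
  · simp [Set.eq_empty_of_isEmpty]
  have h1 : ‖(ContinuousLinearMap.lsmul ℝ ℝ : ℝ →L[ℝ] ℝ →L[ℝ] ℝ)‖ ≤ 1 :=
    ContinuousLinearMap.opNorm_lsmul_le
  have h0 : 0 ≤ C := (abs_nonneg _).trans (hg x)
  gcongr
  exact mul_le_of_le_one_right h0 h1

lemma integral_signedMeasure_toSignedMeasure (μ : Measure X) [IsFiniteMeasure μ] (g : X → ℝ) :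
    ∫ᵛ x, g x ∂•μ.toSignedMeasure = ∫ x, g x ∂μ := by
  have h : (ContinuousLinearMap.lsmul ℝ ℝ : ℝ →L[ℝ] ℝ →L[ℝ] ℝ).flip =
      ContinuousLinearMap.lsmul ℝ ℝ := by
    ext
    simp
  rw [← VectorMeasure.integral_toSignedMeasure (μ := μ) (f := g), h]

lemma integrable_signedMeasure_of_bounded (ν : SignedMeasure X) {g : X → ℝ} {C : ℝ}
    (hm : AEStronglyMeasurable g ν.variation) (hg : ∀ x, |g x| ≤ C) : ν.Integrable g :=
  Integrable.of_bound hm C (ae_of_all _ hg)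

end SignedMeasure

/-! ### Divergence measures vanish on `H^{m-1}`-null sets -/

/-- Rescaled bump functions: `1` on the ball of radius `r`, supported in the ball of radius `2 r`,
with a gradient of `L_1` norm proportional to `r ^ (m - 1)`. -/
lemma exists_bump (m : ℕ) : ∃ C : ℝ, 0 ≤ C ∧ ∀ (c : Eu m) (r : ℝ), 0 < r →
    ∃ φ : Eu m → ℝ, ContDiff ℝ (⊤ : ℕ∞) φ ∧ (∀ x, φ x ∈ Icc (0 : ℝ) 1) ∧
      (∀ x ∈ Metric.ball c r, φ x = 1) ∧
      tsupport φ ⊆ Metric.closedBall c (2 * r) ∧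
      ∫ x, ‖fderiv ℝ φ x‖ ≤ C * (r ^ m * r⁻¹) := by
  let χ : ContDiffBump (0 : Eu m) := ⟨1, 2, one_pos, one_lt_two⟩
  have hχ : ContDiff ℝ (⊤ : ℕ∞) (χ : Eu m → ℝ) := χ.contDiff
  refine ⟨∫ x, ‖fderiv ℝ χ x‖, integral_nonneg fun _ => norm_nonneg _, fun c r hr => ?_⟩
  have hd : ∀ x, HasFDerivAt (fun x : Eu m => χ (r⁻¹ • (x - c)))
      (r⁻¹ • fderiv ℝ χ (r⁻¹ • (x - c))) x := by
    intro x
    have h1 : HasFDerivAt (fun x : Eu m => r⁻¹ • (x - c))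
        (r⁻¹ • ContinuousLinearMap.id ℝ (Eu m)) x :=
      ((hasFDerivAt_id x).sub_const c).const_smul r⁻¹
    have h2 := ((hχ.differentiable (by simp)) (r⁻¹ • (x - c))).hasFDerivAt.comp x h1
    refine HasFDerivAt.congr_fderiv h2 ?_
    ext v
    simp
  refine ⟨fun x => χ (r⁻¹ • (x - c)), ?_, fun x => ⟨χ.nonneg, χ.le_one⟩, fun x hx => ?_, ?_, ?_⟩
  · exact hχ.comp ((contDiff_id.sub contDiff_const).const_smul r⁻¹)
  · refine χ.one_of_mem_closedBall ?_
    rw [mem_closedBall_zero_iff, norm_smul, norm_inv, Real.norm_of_nonneg hr.le]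
    rw [mem_ball_iff_norm] at hx
    exact (inv_mul_le_one₀ hr).2 hx.le
  · refine closure_minimal (fun x hx => ?_) Metric.isClosed_closedBall
    have : r⁻¹ • (x - c) ∈ Function.support χ := hx
    rw [χ.support_eq, mem_ball_zero_iff, norm_smul, norm_inv, Real.norm_of_nonneg hr.le] at this
    rw [mem_closedBall_iff_norm]
    have h2 : r⁻¹ * ‖x - c‖ < 2 := this
    rw [inv_mul_lt_iff₀ hr] at h2
    linarith
  · have h1 : ∀ x, ‖fderiv ℝ (fun x : Eu m => χ (r⁻¹ • (x - c))) x‖ =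
        r⁻¹ * ‖fderiv ℝ χ (r⁻¹ • (x - c))‖ := fun x => by
      rw [(hd x).fderiv, norm_smul, norm_inv, Real.norm_of_nonneg hr.le]
    simp only [h1]
    rw [integral_const_mul, integral_sub_right_eq_self (fun x => ‖fderiv ℝ χ (r⁻¹ • x)‖) c,
      Measure.integral_comp_inv_smul volume (fun x => ‖fderiv ℝ χ x‖) r]
    simp only [finrank_euclideanSpace, Fintype.card_fin, smul_eq_mul,
      abs_of_nonneg (pow_nonneg hr.le m)]
    exact le_of_eq (by ring)

/-- Gluing bumps: if `φ` and `ψ` are cutoff functions, then so is `1 - (1 - φ) * (1 - ψ)`, and its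
gradient is at most the sum of the gradients. -/
lemma exists_cutoff_of_finset {m : ℕ} {C : ℝ} {ι : Type*} (s : Finset ι) (c : ι → Eu m)
    (r : ι → ℝ)
    (h : ∀ i ∈ s, ∃ φ : Eu m → ℝ, ContDiff ℝ (⊤ : ℕ∞) φ ∧ (∀ x, φ x ∈ Icc (0 : ℝ) 1) ∧
      (∀ x ∈ Metric.ball (c i) (r i), φ x = 1) ∧
      tsupport φ ⊆ Metric.closedBall (c i) (2 * r i) ∧
      ∫ x, ‖fderiv ℝ φ x‖ ≤ C * (r i ^ m * (r i)⁻¹)) :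
    ∃ φ : Eu m → ℝ, ContDiff ℝ (⊤ : ℕ∞) φ ∧ (∀ x, φ x ∈ Icc (0 : ℝ) 1) ∧
      (∀ i ∈ s, ∀ x ∈ Metric.ball (c i) (r i), φ x = 1) ∧
      tsupport φ ⊆ ⋃ i ∈ s, Metric.closedBall (c i) (2 * r i) ∧
      ∫ x, ‖fderiv ℝ φ x‖ ≤ C * ∑ i ∈ s, r i ^ m * (r i)⁻¹ := by
  classical
  have key : ∀ (φ : Eu m → ℝ) (K : Set (Eu m)), ContDiff ℝ (⊤ : ℕ∞) φ → IsCompact K →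
      tsupport φ ⊆ K → Integrable fun x => ‖fderiv ℝ φ x‖ := fun φ K hφ hK hs =>
    (hφ.continuous_fderiv (by simp)).norm.integrable_of_hasCompactSupport
      ((HasCompactSupport.fderiv (𝕜 := ℝ) (hK.of_isClosed_subset (isClosed_tsupport _) hs)).norm)
  induction s using Finset.induction_on with
  | empty => exact ⟨0, contDiff_const, by simp, by simp, by simp, by simp⟩
  | insert j s hj ih =>
    obtain ⟨φ, hφ, hφ01, hφ1, hφs, hφi⟩ := ih fun i hi => h i (Finset.mem_insert_of_mem hi)
    obtain ⟨ψ, hψ, hψ01, hψ1, hψs, hψi⟩ := h j (Finset.mem_insert_self _ _)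
    have hφd := hφ.differentiable (by simp)
    have hψd := hψ.differentiable (by simp)
    have hK : IsCompact (⋃ i ∈ s, Metric.closedBall (c i) (2 * r i)) :=
      s.isCompact_biUnion fun i _ => isCompact_closedBall _ _
    have hsupp : tsupport (fun x => φ x + ψ x - φ x * ψ x) ⊆
        ⋃ i ∈ insert j s, Metric.closedBall (c i) (2 * r i) := by
      refine closure_minimal (fun x hx => ?_)
        (Finset.isCompact_biUnion _ fun i _ => isCompact_closedBall _ _).isClosed
      rw [Finset.set_biUnion_insert]
      by_cases h1 : ψ x = 0
      · by_cases h2 : φ x = 0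
        · simp [h1, h2] at hx
        · exact Or.inr (hφs (subset_tsupport _ h2))
      · exact Or.inl (hψs (subset_tsupport _ h1))
    refine ⟨fun x => φ x + ψ x - φ x * ψ x, (hφ.add hψ).sub (hφ.mul hψ), fun x => ?_,
      fun i hi x hx => ?_, hsupp, ?_⟩
    · obtain ⟨h1, h2⟩ := hφ01 x
      obtain ⟨h3, h4⟩ := hψ01 x
      constructor <;> nlinarith
    · rcases Finset.mem_insert.1 hi with rfl | hi
      · simp [hψ1 x hx]
      · simp [hφ1 i hi x hx]
    · have hfd : ∀ x, ‖fderiv ℝ (fun x => φ x + ψ x - φ x * ψ x) x‖ ≤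
          ‖fderiv ℝ φ x‖ + ‖fderiv ℝ ψ x‖ := by
        intro x
        have hd : HasFDerivAt (fun x => φ x + ψ x - φ x * ψ x)
            ((1 - ψ x) • fderiv ℝ φ x + (1 - φ x) • fderiv ℝ ψ x) x := by
          have h1 := (hφd x).hasFDerivAt
          have h2 := (hψd x).hasFDerivAt
          refine ((h1.add h2).sub (h1.mul h2)).congr_fderiv ?_
          module
        rw [hd.fderiv]
        refine (norm_add_le _ _).trans ?_
        rw [norm_smul, norm_smul, Real.norm_of_nonneg (sub_nonneg.2 (hψ01 x).2),
          Real.norm_of_nonneg (sub_nonneg.2 (hφ01 x).2)]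
        have := (hψ01 x).1
        have := (hφ01 x).1
        exact add_le_add (mul_le_of_le_one_left (norm_nonneg _) (by linarith))
          (mul_le_of_le_one_left (norm_nonneg _) (by linarith))
      have i1 := key φ _ hφ hK hφs
      have i2 := key ψ _ hψ (isCompact_closedBall _ _) hψs
      calc ∫ x, ‖fderiv ℝ (fun x => φ x + ψ x - φ x * ψ x) x‖
          ≤ ∫ x, (‖fderiv ℝ φ x‖ + ‖fderiv ℝ ψ x‖) :=
            integral_mono_of_nonneg (ae_of_all _ fun _ => norm_nonneg _) (i1.add i2)
              (ae_of_all _ hfd)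
        _ = (∫ x, ‖fderiv ℝ φ x‖) + ∫ x, ‖fderiv ℝ ψ x‖ := integral_add i1 i2
        _ ≤ C * ∑ i ∈ insert j s, r i ^ m * (r i)⁻¹ := by
            rw [Finset.sum_insert hj, mul_add]
            linarith

/-- A compact set of vanishing Hausdorff measure is covered by finitely many small balls with
centres on the set, whose radii have a small `d`-th power sum. -/
lemma exists_finset_ball_cover {X : Type*} [MetricSpace X] [Nonempty X]
    [MeasurableSpace X] [BorelSpace X] {d : ℝ} (hd : 0 ≤ d)
    {K : Set X} (hK : IsCompact K) (h0 : μH[d] K = 0) {δ η : ℝ≥0∞}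
    (hδ : δ ≠ 0) (hδ' : δ ≠ ∞) (hη : η ≠ 0) :
    ∃ (s : Finset ℕ) (c : ℕ → X) (r : ℕ → ℝ≥0∞), (∀ i ∈ s, c i ∈ K) ∧
      (∀ i ∈ s, 0 < r i ∧ r i < δ) ∧ K ⊆ ⋃ i ∈ s, Metric.eball (c i) (r i) ∧
      ∑ i ∈ s, r i ^ d ≤ η := by
  have hη2 : η / 2 ≠ 0 := (ENNReal.half_pos hη).ne'
  have hδ2 : δ / 2 < δ := ENNReal.half_lt_self hδ hδ'
  rw [Measure.hausdorffMeasure_apply] at h0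
  have h1 := iSup₂_le_iff.1 h0.le (δ / 2) (ENNReal.half_pos hδ)
  have h2 := lt_of_le_of_lt h1 (pos_iff_ne_zero.2 hη2)
  simp only [iInf_lt_iff] at h2
  obtain ⟨t, hKt, hdiam, hsum⟩ := h2
  obtain ⟨e, he, hesum⟩ := ENNReal.exists_pos_sum_of_countable' hη2 ℕ
  -- the radii exceed the diameters, so that open balls around points of `t n` contain `t n`
  have hr : ∀ n, ∃ x, Metric.ediam (t n) < x ∧ x < δ ∧
      x ^ d < Metric.ediam (t n) ^ d + e n := by
    intro n
    have hlt : Metric.ediam (t n) < δ := (hdiam n).trans_lt hδ2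
    have hne : Metric.ediam (t n) ^ d ≠ ∞ := ENNReal.rpow_ne_top_of_nonneg hd hlt.ne_top
    have hc : ∀ᶠ x in 𝓝[>] Metric.ediam (t n), x ^ d < Metric.ediam (t n) ^ d + e n :=
      ((ENNReal.continuous_rpow_const.tendsto _).eventually_lt_const
        (ENNReal.lt_add_right hne (he n).ne')).filter_mono nhdsWithin_le_nhds
    have hNe : (𝓝[>] Metric.ediam (t n)).NeBot := nhdsGT_neBot_of_exists_gt ⟨δ, hlt⟩
    obtain ⟨x, hx1, hx2, hx3⟩ := (hc.and ((eventually_mem_nhdsWithin).and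
      ((eventually_lt_nhds hlt).filter_mono nhdsWithin_le_nhds))).exists
    exact ⟨x, hx2, hx3, hx1⟩
  choose r hr1 hr2 hr3 using hr
  have hne : ∀ n, (K ∩ t n).Nonempty → (t n).Nonempty := fun n h => h.mono inter_subset_right
  classical
  let c : ℕ → X := fun n => if h : (K ∩ t n).Nonempty then h.some else Classical.arbitrary X
  have hc : ∀ n, (K ∩ t n).Nonempty → c n ∈ K ∧ c n ∈ t n := fun n h => by
    simp only [c, dif_pos h]
    exact h.some_mem
  obtain ⟨F, hFI, hFfin, hF⟩ := hK.elim_finite_subcover_image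
    (b := {n | (K ∩ t n).Nonempty}) (c := fun n => Metric.eball (c n) (r n))
    (fun _ _ => Metric.isOpen_eball) (fun x hx => by
      obtain ⟨n, hn⟩ := mem_iUnion.1 (hKt hx)
      have hI : (K ∩ t n).Nonempty := ⟨x, hx, hn⟩
      refine mem_biUnion (x := n) (mem_ofPred.2 hI) ?_
      exact (Metric.edist_le_ediam_of_mem hn (hc n hI).2).trans_lt (hr1 n))
  refine ⟨hFfin.toFinset, c, r, ?_, fun i _ => ⟨zero_le.trans_lt (hr1 i), hr2 i⟩, ?_, ?_⟩
  · intro i hi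
    exact (hc i (hFI (hFfin.mem_toFinset.1 hi))).1
  · simpa using hF
  · calc ∑ i ∈ hFfin.toFinset, r i ^ d
        ≤ ∑ i ∈ hFfin.toFinset, ((⨆ _ : (t i).Nonempty, Metric.ediam (t i) ^ d) + e i) := by
          refine Finset.sum_le_sum fun i hi => (hr3 i).le.trans ?_
          have := hne i (hFI (hFfin.mem_toFinset.1 hi))
          rw [ciSup_pos this]
      _ ≤ ∑' i, ((⨆ _ : (t i).Nonempty, Metric.ediam (t i) ^ d) + e i) := ENNReal.sum_le_tsum _
      _ = (∑' i, ⨆ _ : (t i).Nonempty, Metric.ediam (t i) ^ d) + ∑' i, e i := ENNReal.tsum_add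
      _ ≤ η / 2 + η / 2 := add_le_add hsum.le hesum.le
      _ = η := ENNReal.add_halves η

section AbsoluteContinuity

variable {m : ℕ} {U : Opens (Eu m)}

/-- A compact set of vanishing `H^{m-1}` measure has zero `1`-capacity: it admits cutoff functions
supported near it whose gradients are arbitrarily small in `L_1`. -/
lemma exists_testFunction_of_hausdorffMeasure_eq_zero (hm : 1 ≤ m) {K V : Set (Eu m)}
    (hK : IsCompact K) (hV : IsOpen V) (hKV : K ⊆ V) (hVU : V ⊆ U)
    (h0 : μH[(m : ℝ) - 1] K = 0) {ε : ℝ} (hε : 0 < ε) :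
    ∃ φ : 𝓓(U, ℝ), (∀ x, φ x ∈ Icc (0 : ℝ) 1) ∧ (∀ x ∈ K, φ x = 1) ∧ (∀ x ∉ V, φ x = 0) ∧
      ‖gradLp φ‖ ≤ ε := by
  obtain ⟨C, hC, hb⟩ := exists_bump m
  obtain ⟨ρ, hρ, hρV⟩ := hK.exists_cthickening_subset_open hV hKV
  have hd : (0 : ℝ) ≤ (m : ℝ) - 1 := by
    have : (1 : ℝ) ≤ m := by exact_mod_cast hm
    linarith
  have hη : 0 < ε / (C + 1) := by positivity
  obtain ⟨s, c, r, hcK, hr, hKs, hsum⟩ := exists_finset_ball_cover hd hK h0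
    (δ := ENNReal.ofReal (ρ / 2)) (η := ENNReal.ofReal (ε / (C + 1)))
    (by simpa using by positivity) ENNReal.ofReal_ne_top (by simpa using hη)
  have hrtop : ∀ i ∈ s, r i ≠ ∞ := fun i hi => ((hr i hi).2.trans ENNReal.ofReal_lt_top).ne
  have hrpos : ∀ i ∈ s, 0 < (r i).toReal := fun i hi =>
    ENNReal.toReal_pos (hr i hi).1.ne' (hrtop i hi)
  have hrlt : ∀ i ∈ s, 2 * (r i).toReal ≤ ρ := fun i hi => by
    have := ENNReal.toReal_mono ENNReal.ofReal_ne_top (hr i hi).2.le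
    rw [ENNReal.toReal_ofReal (by positivity)] at this
    linarith
  obtain ⟨φ, hφ, hφ01, hφ1, hφs, hφi⟩ := exists_cutoff_of_finset (C := C) s c
    (fun i => (r i).toReal) fun i hi => hb (c i) _ (hrpos i hi)
  have hsV : tsupport φ ⊆ V := by
    refine hφs.trans (iUnion₂_subset fun i hi => ?_)
    refine (Metric.closedBall_subset_closedBall (hrlt i hi)).trans (Subset.trans ?_ hρV)
    exact Metric.closedBall_subset_cthickening (hcK i hi) ρ
  have hcs : HasCompactSupport φ := HasCompactSupport.of_support_subset_isCompact
    (s.isCompact_biUnion fun i _ => isCompact_closedBall (c i) (2 * (r i).toReal))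
    ((subset_tsupport _).trans hφs)
  let Φ : 𝓓(U, ℝ) := ⟨φ, hφ, hcs, hsV.trans hVU⟩
  have hΦ : ∀ x, Φ x = φ x := fun _ => rfl
  refine ⟨Φ, hφ01, fun x hx => ?_, fun x hx => image_eq_zero_of_notMem_tsupport fun h => hx (hsV h),
    ?_⟩
  · obtain ⟨i, hi, hxi⟩ := mem_iUnion₂.1 (hKs hx)
    refine hφ1 i hi x ?_
    rw [← Metric.eball_ofReal, ENNReal.ofReal_toReal (hrtop i hi)]
    exact hxi
  · have hnorm : ∀ x, ‖gradient Φ x‖ = ‖fderiv ℝ φ x‖ := fun x =>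
      (InnerProductSpace.toDual ℝ (Eu m)).symm.norm_map _
    have hpow : ∀ i ∈ s, ENNReal.ofReal ((r i).toReal ^ m * ((r i).toReal)⁻¹) =
        r i ^ ((m : ℝ) - 1) := fun i hi => by
      rw [← Real.rpow_natCast, ← div_eq_mul_inv, ← Real.rpow_sub_one (hrpos i hi).ne',
        ← ENNReal.ofReal_rpow_of_pos (hrpos i hi), ENNReal.ofReal_toReal (hrtop i hi)]
    have hsum' : ∑ i ∈ s, (r i).toReal ^ m * ((r i).toReal)⁻¹ ≤ ε / (C + 1) := by
      rw [← ENNReal.ofReal_le_ofReal_iff hη.le, ENNReal.ofReal_sum_of_nonneg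
        fun i hi => mul_nonneg (pow_nonneg (hrpos i hi).le _) (inv_nonneg.2 (hrpos i hi).le),
        Finset.sum_congr rfl hpow]
      exact hsum
    have hzero : ∀ x ∉ U, ‖gradient Φ x‖ = 0 := fun x hx => by
      have h1 : x ∉ tsupport (gradient (Φ : Eu m → ℝ)) := fun h => hx (hVU (hsV
        (((tsupport_comp_subset (map_zero _) _).trans
          (tsupport_fderiv_subset ℝ (f := φ))) h)))
      rw [image_eq_zero_of_notMem_tsupport h1, norm_zero]
    rw [norm_gradLp, integral_leb_eq (g := fun x => ‖gradient Φ x‖) hzero]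
    simp only [hnorm]
    refine hφi.trans ((mul_le_mul_of_nonneg_left hsum' hC).trans ?_)
    rw [mul_div_assoc', div_le_iff₀ (by positivity)]
    nlinarith

/-- The divergence measure of a bounded field does not charge compact sets of vanishing `H^{m-1}`
measure. -/
lemma HasDiv.apply_isCompact_eq_zero (hm : 1 ≤ m) {u : LpField U ∞} {ν : SignedMeasure U}
    (h : HasDiv u ν) {K : Set U} (hK : IsCompact K) (h0 : μH[(m : ℝ) - 1] K = 0) : ν K = 0 := by
  have hd : (0 : ℝ) ≤ (m : ℝ) - 1 := by
    have : (1 : ℝ) ≤ m := by exact_mod_cast hm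
    linarith
  rw [← norm_le_zero_iff]
  refine le_of_forall_pos_le_add fun ε hε => ?_
  obtain ⟨V, hKV, hV, hVε⟩ := hK.measurableSet.exists_isOpen_sdiff_lt (μ := ν.variation)
    (measure_ne_top _ _) (ε := ENNReal.ofReal (ε / 2)) (by simpa using hε)
  have h0' : μH[(m : ℝ) - 1] (Subtype.val '' K : Set (Eu m)) = 0 := by
    rw [isometry_subtype_coe.hausdorffMeasure_image (Or.inl hd), h0]
  obtain ⟨φ, hφ01, hφ1, hφ0, hφε⟩ := exists_testFunction_of_hausdorffMeasure_eq_zero hm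
    (hK.image continuous_subtype_val) (U.isOpen.isOpenMap_subtype_val V hV) (image_mono hKV)
    (Subtype.coe_image_subset _ _) h0' (ε := ε / (2 * (‖u‖ + 1))) (by positivity)
  have h1 : |∫ᵛ x, φ (x : Eu m) ∂•ν| ≤ ε / 2 := by
    rw [← abs_neg, ← hasDiv_iff_pairing.1 h φ]
    refine (abs_pairing_le _ _).trans ((mul_le_mul_of_nonneg_right hφε (norm_nonneg _)).trans ?_)
    rw [div_mul_eq_mul_div, div_le_div_iff₀ (by positivity) two_pos]
    nlinarith [norm_nonneg u]
  have hK1 : ν.Integrable (K.indicator fun _ => (1 : ℝ)) :=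
    (integrable_const (1 : ℝ)).indicator hK.measurableSet
  have h2 : ν K = ∫ᵛ x, K.indicator (fun _ => (1 : ℝ)) x ∂•ν := by
    rw [VectorMeasure.integral_indicator hK.measurableSet]
    simp [VectorMeasure.restrict_apply, hK.measurableSet]
  have h3 : |ν K - ∫ᵛ x, φ (x : Eu m) ∂•ν| ≤ ε / 2 := by
    rw [h2, ← VectorMeasure.integral_fun_sub hK1 (integrable_testFunction ν φ)]
    refine (VectorMeasure.norm_integral_le_lintegral_norm
      (B := (ContinuousLinearMap.lsmul ℝ ℝ : ℝ →L[ℝ] ℝ →L[ℝ] ℝ))).trans ?_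
    refine (mul_le_of_le_one_left ENNReal.toReal_nonneg
      ContinuousLinearMap.opNorm_lsmul_le).trans ?_
    refine ENNReal.toReal_le_of_le_ofReal (by positivity) (le_trans ?_ hVε.2.le)
    rw [← lintegral_indicator_one (hV.measurableSet.diff hK.measurableSet)]
    refine lintegral_mono fun x => ?_
    by_cases hxK : x ∈ K
    · simp [hxK, hφ1 x ⟨x, hxK, rfl⟩]
    · by_cases hxV : x ∈ V
      · have := hφ01 x
        simp only [hxK, not_false_eq_true, indicator_of_notMem, zero_sub, norm_neg,
          Set.mem_sdiff, hxV, and_self, indicator_of_mem, Pi.one_apply]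
        rw [Real.norm_of_nonneg this.1]
        exact ENNReal.ofReal_le_one.2 this.2
      · have : φ (x : Eu m) = 0 := hφ0 x fun ⟨y, hy, hyx⟩ => hxV (Subtype.ext hyx ▸ hy)
        simp [hxK, this]
  rw [Real.norm_eq_abs]
  have := abs_sub_abs_le_abs_sub (ν K) (∫ᵛ x, φ (x : Eu m) ∂•ν)
  linarith

/-- The divergence measure of a bounded field is absolutely continuous with respect to `H^{m-1}`. -/
lemma HasDiv.variation_absolutelyContinuous (hm : 1 ≤ m) {u : LpField U ∞} {ν : SignedMeasure U}
    (h : HasDiv u ν) : ν.variation ≪ (μH[(m : ℝ) - 1] : Measure U) := by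
  -- the variation of `ν` is inner regular, which reduces the claim to compact sets
  refine Measure.AbsolutelyContinuous.mk fun s hs hs0 => ?_
  rw [VectorMeasure.variation_apply_eq_zero hs]
  intro t hts ht
  have : LocallyCompactSpace U := U.isOpen.locallyCompactSpace
  by_contra hne
  obtain ⟨K, hKt, hK, hKε⟩ := ht.exists_isCompact_sdiff_lt (μ := ν.variation)
    (measure_ne_top _ _) (enorm_ne_zero.2 hne)
  have h1 : ν t = ν (t \ K) := by
    rw [← VectorMeasure.of_add_of_sdiff hK.measurableSet ht hKt,
      h.apply_isCompact_eq_zero hm hK (measure_mono_null (hKt.trans hts) hs0), zero_add]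
  rw [h1] at hKε
  exact absurd hKε (VectorMeasure.enorm_measure_le_variation _ _).not_gt

end AbsoluteContinuity

/-! ### The Gauss functional -/

section Gauss

variable {m : ℕ} {U : Opens (Eu m)} {f fbar : U → ℝ} {C : ℝ}

/-- `H^{m-1}`-almost equal functions are almost equal for every divergence measure. -/
lemma HasDiv.ae_eq (hm : 1 ≤ m) (hae : fbar =ᵐ[μH[(m : ℝ) - 1]] f) {u : LpField U ∞}
    {ν : SignedMeasure U} (h : HasDiv u ν) : fbar =ᵐ[ν.variation] f :=
  (h.variation_absolutelyContinuous hm).ae_eq hae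

lemma HasDiv.integrable (hm : 1 ≤ m) (hfbar : Measurable[suslin U] fbar)
    (hae : fbar =ᵐ[μH[(m : ℝ) - 1]] f) (hC : ∀ x, |f x| ≤ C) {u : LpField U ∞}
    {ν : SignedMeasure U} (h : HasDiv u ν) : ν.Integrable f :=
  integrable_signedMeasure_of_bounded ν
    ((aestronglyMeasurable_of_measurable_suslin hfbar _).congr (h.ae_eq hm hae)) hC

lemma HasDiv.neg {u : LpField U ∞} {ν : SignedMeasure U} (h : HasDiv u ν) : HasDiv (-u) (-ν) := by
  have hν : (-1 : ℝ) • ν = -ν := by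
    ext s
    simp
  simpa only [neg_one_smul, hν] using h.smul (-1)

lemma HasDiv.sub {u v : LpField U ∞} {μ ν : SignedMeasure U} (hu : HasDiv u μ)
    (hv : HasDiv v ν) : HasDiv (u - v) (μ - ν) := by
  simpa only [sub_eq_add_neg] using hu.add hv.neg

lemma integral_le_bfNorm (hf : bfNorm f < ∞) {u : LpField U ∞} {ν : SignedMeasure U}
    (h : HasDiv u ν) (hu : ‖u‖ ≤ 1) : ∫ᵛ x, f x ∂•ν ≤ (bfNorm f).toReal := by
  refine (ENNReal.ofReal_le_iff_le_toReal hf.ne).1 ?_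
  exact le_iSup_of_le u (le_iSup_of_le ν (le_iSup_of_le h (le_iSup_of_le hu le_rfl)))

/-- The divergence integral of `f` is bounded by `‖f‖_BF ‖u‖`; in particular it vanishes when
`u = 0`, so that it depends on `u` only. -/
lemma abs_integral_le_bfNorm (hf : bfNorm f < ∞) {u : LpField U ∞} {ν : SignedMeasure U}
    (h : HasDiv u ν) : |∫ᵛ x, f x ∂•ν| ≤ (bfNorm f).toReal * ‖u‖ := by
  have key : ∀ {u : LpField U ∞} {ν : SignedMeasure U}, HasDiv u ν →
      ∫ᵛ x, f x ∂•ν ≤ (bfNorm f).toReal * ‖u‖ := by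
    intro u ν h
    have hs : ∀ c : ℝ, 0 ≤ c → c * ‖u‖ ≤ 1 → c * ∫ᵛ x, f x ∂•ν ≤ (bfNorm f).toReal := by
      intro c hc hcu
      have := integral_le_bfNorm hf (h.smul c) (by
        rwa [norm_smul, Real.norm_of_nonneg hc])
      rwa [VectorMeasure.integral_smul_vectorMeasure] at this
    rcases (norm_nonneg u).eq_or_lt with h0 | hpos
    · rw [← h0, mul_zero]
      by_contra! hlt
      have := hs (((bfNorm f).toReal + 1) / ∫ᵛ x, f x ∂•ν) (by positivity) (by simp [← h0])
      rw [div_mul_cancel₀ _ hlt.ne'] at this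
      linarith
    · have := hs ‖u‖⁻¹ (by positivity) (inv_mul_cancel₀ hpos.ne').le
      rwa [inv_mul_le_iff₀ hpos, mul_comm] at this
  refine abs_le.2 ⟨?_, key h⟩
  have := key h.neg
  rw [VectorMeasure.integral_neg_vectorMeasure, norm_neg] at this
  linarith

/-- The functional `u ↦ -∫ f d(div u)` is well defined and bounded on the fields with measure
divergence; a Hahn–Banach extension provides it on the closure, and its norm is `‖f‖_BF`. -/
theorem exists_isGaussFunctional (hm : 1 ≤ m) (hf : bfNorm f < ∞)
    (hfbar : Measurable[suslin U] fbar) (hae : fbar =ᵐ[μH[(m : ℝ) - 1]] f)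
    (hC : ∀ x, |f x| ≤ C) : ∃ μ : StrongDual ℝ (DB U), IsGaussFunctional f μ := by
  have hint : ∀ {u : LpField U ∞} {ν : SignedMeasure U}, HasDiv u ν → ν.Integrable f :=
    fun h => h.integrable hm hfbar hae hC
  have huniq : ∀ {u : LpField U ∞} {ν ν' : SignedMeasure U}, HasDiv u ν → HasDiv u ν' →
      ∫ᵛ x, f x ∂•ν = ∫ᵛ x, f x ∂•ν' := by
    intro u ν ν' h h'
    have := abs_integral_le_bfNorm hf (h.sub h')
    rw [sub_self, norm_zero, mul_zero, VectorMeasure.integral_sub_vectorMeasure (hint h) (hint h'),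
      abs_nonpos_iff] at this
    exact sub_eq_zero.1 this
  let div : DM U → SignedMeasure U := fun u => u.2.choose
  have hdiv : ∀ u : DM U, HasDiv (u : LpField U ∞) (div u) := fun u => u.2.choose_spec
  let L : DM U →ₗ[ℝ] ℝ :=
    { toFun := fun u => -∫ᵛ x, f x ∂•div u
      map_add' := fun u v => by
        rw [huniq (hdiv (u + v)) ((hdiv u).add (hdiv v)),
          VectorMeasure.integral_add_vectorMeasure (hint (hdiv u)) (hint (hdiv v)), neg_add]
      map_smul' := fun c u => by
        rw [huniq (hdiv (c • u)) ((hdiv u).smul c), VectorMeasure.integral_smul_vectorMeasure,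
          RingHom.id_apply, smul_neg] }
  have hL : ∀ u : DM U, ‖L u‖ ≤ (bfNorm f).toReal * ‖u‖ := fun u => by
    rw [Real.norm_eq_abs]
    change |-∫ᵛ x, f x ∂•div u| ≤ _
    rw [abs_neg]
    exact abs_integral_le_bfNorm hf (hdiv u)
  obtain ⟨g, hg, hgn⟩ := exists_extension_norm_eq (DM U) (L.mkContinuous _ hL)
  have hgL : ∀ (u : LpField U ∞) (ν : SignedMeasure U), HasDiv u ν → g u = -∫ᵛ x, f x ∂•ν := by
    intro u ν h
    have := hg ⟨u, ν, h⟩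
    rw [LinearMap.mkContinuous_apply] at this
    refine this.trans ?_
    exact congrArg Neg.neg (huniq (hdiv ⟨u, ν, h⟩) h)
  refine ⟨g.comp (DB U).subtypeL, fun u ν h => hgL u ν h, le_antisymm ?_ ?_⟩
  · rw [← ofReal_norm]
    refine ENNReal.ofReal_le_of_le_toReal ?_
    refine ContinuousLinearMap.opNorm_le_bound _ ENNReal.toReal_nonneg fun u => ?_
    refine (g.le_opNorm _).trans (mul_le_mul_of_nonneg_right ?_ (norm_nonneg _))
    rw [hgn]
    exact LinearMap.mkContinuous_norm_le _ ENNReal.toReal_nonneg _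
  · refine iSup_le fun u => iSup_le fun ν => iSup_le fun h => iSup_le fun hu => ?_
    rw [← ofReal_norm]
    refine ENNReal.ofReal_le_ofReal ?_
    have h1 : (g.comp (DB U).subtypeL) ⟨u, DM_le_DB U ⟨ν, h⟩⟩ = -∫ᵛ x, f x ∂•ν := hgL u ν h
    have h2 := (g.comp (DB U).subtypeL).le_opNorm ⟨u, DM_le_DB U ⟨ν, h⟩⟩
    rw [h1, norm_neg] at h2
    refine (le_abs_self _).trans (h2.trans ?_)
    exact mul_le_of_le_one_right (ContinuousLinearMap.opNorm_nonneg _) hu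

theorem isGaussFunctional_gaussFunctional (h : ∃ μ : StrongDual ℝ (DB U), IsGaussFunctional f μ) :
    IsGaussFunctional f (gaussFunctional f) := by
  rw [gaussFunctional, dif_pos h]
  exact h.choose_spec

end Gauss

/-! ### Representation of functionals -/

section Representation

variable {m : ℕ} {U : Opens (Eu m)}

/-- The square integrable weight `(1 + ‖x‖)^{-(m+1)}`. -/
def weight (x : Eu m) : ℝ := (1 + ‖x‖) ^ (-((m : ℝ) + 1))

lemma weight_pos (x : Eu m) : 0 < weight x := Real.rpow_pos_of_pos (by positivity) _

lemma weight_continuous : Continuous (weight : Eu m → ℝ) := by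
  refine (continuous_const.add continuous_norm).rpow_const fun x => Or.inl ?_
  have : 0 < 1 + ‖x‖ := by positivity
  exact this.ne'

lemma memLp_leb {E : Type*} [NormedAddCommGroup E] {g : Eu m → E} {p : ℝ≥0∞}
    (hg : MemLp g p volume) : MemLp (fun x : U => g x) p (leb U) := by
  have h := hg.restrict (U : Set (Eu m))
  rw [← map_comap_subtype_coe U.isOpen.measurableSet volume] at h
  exact ((MeasurableEmbedding.subtype_coe U.isOpen.measurableSet).memLp_map_measure_iff).1 h

lemma memLp_two_weight : MemLp (fun x : U => weight (x : Eu m)) 2 (leb U) := by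
  refine memLp_leb (g := weight) ?_
  have hint : Integrable (weight : Eu m → ℝ) volume := integrable_one_add_norm (by simp)
  refine (memLp_two_iff_integrable_sq weight_continuous.aestronglyMeasurable).2 ?_
  refine hint.mono' (weight_continuous.pow 2).aestronglyMeasurable (ae_of_all _ fun x => ?_)
  have h0 := (weight_pos x).le
  have h1 : weight x ≤ 1 := Real.rpow_le_one_of_one_le_of_nonpos (by simp)
    (by linarith [Nat.cast_nonneg (α := ℝ) m])
  rw [Real.norm_of_nonneg (sq_nonneg _)]
  nlinarith

/-- Multiplication of a square integrable field by the weight. -/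
def weightMul : Lp (Eu m) 2 (leb U) →L[ℝ] LpField U 1 :=
  (ContinuousLinearMap.lsmul ℝ ℝ : ℝ →L[ℝ] Eu m →L[ℝ] Eu m).holderL (leb U) 2 2 1
    (memLp_two_weight.toLp _)

lemma coeFn_weightMul (g : Lp (Eu m) 2 (leb U)) :
    weightMul g =ᵐ[leb U] fun x => weight (x : Eu m) • g x := by
  filter_upwards [(ContinuousLinearMap.lsmul ℝ ℝ : ℝ →L[ℝ] Eu m →L[ℝ] Eu m).coeFn_holder (r := 1)
    (memLp_two_weight.toLp _) g, memLp_two_weight.coeFn_toLp (μ := leb U)] with x hx hHx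
  refine hx.trans ?_
  rw [hHx]
  rfl

/-- If a square integrable field `k` represents the functional `l` on weighted fields, then `k` is
bounded by `‖l‖` times the weight: test with `k` cut off to the set where this bound fails. -/
lemma ae_norm_le_weight (l : StrongDual ℝ (LpField U 1)) (k : Lp (Eu m) 2 (leb U))
    (hk : ∀ g, l (weightMul g) = ∫ x, inner ℝ (k x) (g x) ∂leb U) :
    ∀ᵐ x ∂leb U, ‖k x‖ ≤ ‖l‖ * weight (x : Eu m) := by
  have hkm : Measurable fun x => ‖k x‖ := (Lp.stronglyMeasurable k).norm.measurable
  have hwm : Measurable fun x : U => weight (x : Eu m) :=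
    (weight_continuous.comp continuous_subtype_val).measurable
  let A : Set U := {x | ‖l‖ * weight (x : Eu m) < ‖k x‖}
  have hA : MeasurableSet A := measurableSet_lt (hwm.const_mul _) hkm
  have hgm : MemLp (A.indicator k) 2 (leb U) := (Lp.memLp k).indicator hA
  let g : Lp (Eu m) 2 (leb U) := hgm.toLp _
  have hg : g =ᵐ[leb U] A.indicator k := hgm.coeFn_toLp
  have e1 : l (weightMul g) = ∫ x, A.indicator (fun x => ‖k x‖ ^ 2) x ∂leb U := by
    rw [hk]
    refine integral_congr_ae ?_
    filter_upwards [hg] with x hx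
    rw [hx]
    by_cases hxA : x ∈ A <;> simp [hxA]
  have e2 : ‖weightMul g‖ =
      ∫ x : U, A.indicator (fun x => weight (x : Eu m) * ‖k x‖) x ∂leb U := by
    rw [L1.norm_eq_integral_norm]
    refine integral_congr_ae ?_
    filter_upwards [hg, coeFn_weightMul g] with x hx hTx
    rw [hTx, hx, norm_smul, Real.norm_of_nonneg (weight_pos _).le]
    by_cases hxA : x ∈ A <;> simp [hxA]
  have i1 : Integrable (A.indicator fun x => ‖k x‖ ^ 2) (leb U) :=
    ((memLp_two_iff_integrable_sq_norm (Lp.aestronglyMeasurable k)).1 (Lp.memLp k)).indicator hA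
  have i2 : Integrable (A.indicator fun x : U => weight (x : Eu m) * ‖k x‖) (leb U) :=
    (memLp_two_weight.integrable_mul (Lp.memLp k).norm).indicator hA
  have hle : ∫ x, (A.indicator (fun x => ‖k x‖ ^ 2) x -
      ‖l‖ * A.indicator (fun x : U => weight (x : Eu m) * ‖k x‖) x) ∂leb U ≤ 0 := by
    rw [integral_sub i1 (i2.const_mul _), integral_const_mul, ← e1, ← e2, sub_nonpos]
    exact (le_abs_self _).trans (l.le_opNorm _)
  have hnn : ∀ x, 0 ≤ A.indicator (fun x => ‖k x‖ ^ 2) x -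
      ‖l‖ * A.indicator (fun x : U => weight (x : Eu m) * ‖k x‖) x := by
    intro x
    by_cases hxA : x ∈ A
    · have : ‖l‖ * weight (x : Eu m) < ‖k x‖ := hxA
      simp only [hxA, indicator_of_mem]
      nlinarith [norm_nonneg (k x)]
    · simp [hxA]
  have hz := (integral_eq_zero_iff_of_nonneg hnn (i1.sub (i2.const_mul _))).1
    (le_antisymm hle (integral_nonneg hnn))
  filter_upwards [hz] with x hx
  by_contra! hlt
  have hxA : x ∈ A := hlt
  simp only [hxA, indicator_of_mem, Pi.zero_apply] at hx
  have h0 : 0 ≤ ‖l‖ * weight (x : Eu m) := mul_nonneg (norm_nonneg _) (weight_pos _).le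
  nlinarith [norm_nonneg (k x)]

/-- A continuous functional on `L_1(U; ℝ^m)` is represented by a bounded field on the gradients of
test functions. Composing with the multiplication by a square integrable weight reduces this to the
Fréchet–Riesz theorem in `L_2`. -/
lemma exists_field_of_dual (l : StrongDual ℝ (LpField U 1)) :
    ∃ w : LpField U ∞, ‖w‖ ≤ ‖l‖ ∧ ∀ φ : 𝓓(U, ℝ), l (gradLp φ) = pairing (gradLp φ) w := by
  let k : Lp (Eu m) 2 (leb U) := (InnerProductSpace.toDual ℝ _).symm (l.comp weightMul)
  have hk : ∀ g, l (weightMul g) = ∫ x, inner ℝ (k x) (g x) ∂leb U := by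
    intro g
    rw [← L2.inner_def, InnerProductSpace.toDual_symm_apply]
    rfl
  have hinv : Continuous fun x : Eu m => (weight x)⁻¹ :=
    weight_continuous.inv₀ fun x => (weight_pos x).ne'
  have hwb : ∀ᵐ x : U ∂leb U, ‖(weight (x : Eu m))⁻¹ • k x‖ ≤ ‖l‖ := by
    filter_upwards [ae_norm_le_weight l k hk] with x hx
    rw [norm_smul, norm_inv, Real.norm_of_nonneg (weight_pos _).le,
      inv_mul_le_iff₀ (weight_pos _), mul_comm]
    exact hx
  have hwm : MemLp (fun x : U => (weight (x : Eu m))⁻¹ • k x) ∞ (leb U) :=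
    memLp_top_of_bound ((hinv.comp continuous_subtype_val).aestronglyMeasurable.smul
      (Lp.aestronglyMeasurable k)) ‖l‖ hwb
  refine ⟨hwm.toLp _, ?_, fun φ => ?_⟩
  · rw [Lp.norm_toLp, eLpNorm_exponent_top]
    refine ENNReal.toReal_le_of_le_ofReal (norm_nonneg _) ?_
    exact eLpNormEssSup_le_of_ae_bound hwb
  · have hgm : MemLp (fun x : U => (weight (x : Eu m))⁻¹ • gradient φ (x : Eu m)) 2 (leb U) :=
      memLp_leb (g := fun x => (weight x)⁻¹ • gradient φ x)
        ((hinv.smul (gradient_continuous φ)).memLp_of_hasCompactSupport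
          (gradient_hasCompactSupport φ).smul_left)
    have hTg : weightMul (hgm.toLp _) = gradLp φ := by
      refine Lp.ext ?_
      filter_upwards [coeFn_weightMul (hgm.toLp _), hgm.coeFn_toLp, coeFn_gradLp φ] with x h1 h2 h3
      rw [h1, h2, h3, smul_smul, mul_inv_cancel₀ (weight_pos _).ne', one_smul]
    rw [pairing_gradLp, ← hTg, hk]
    refine integral_congr_ae ?_
    filter_upwards [hgm.coeFn_toLp, hwm.coeFn_toLp] with x h1 h2
    rw [h1, h2, inner_smul_right, real_inner_smul_left]

/-- A positive functional on compactly supported functions that is bounded on those with values in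
`[0, 1]` is represented by a finite measure, whose mass is the best such bound. -/
lemma exists_finiteMeasure_of_positive {X : Type*} [TopologicalSpace X] [T2Space X]
    [LocallyCompactSpace X] [MeasurableSpace X] [BorelSpace X] (l : C_c(X, ℝ) →ₗ[ℝ] ℝ)
    (hl : ∀ g : C_c(X, ℝ), 0 ≤ g → 0 ≤ l g) {S₀ : ℝ}
    (hS₀ : ∀ g : C_c(X, ℝ), (∀ x, g x ∈ Icc (0 : ℝ) 1) → l g ≤ S₀) :
    ∃ (ν : Measure X) (_ : IsFiniteMeasure ν), (∀ g : C_c(X, ℝ), l g = ∫ x, g x ∂ν) ∧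
      ∀ S : ℝ, (∀ g : C_c(X, ℝ), (∀ x, g x ∈ Icc (0 : ℝ) 1) → l g ≤ S) → ν.real univ ≤ S := by
  let L : C_c(X, ℝ) →ₚ[ℝ] ℝ := PositiveLinearMap.mk₀ l hl
  let ν := RealRMK.rieszMeasure L
  have hν : ∀ S : ℝ, (∀ g : C_c(X, ℝ), (∀ x, g x ∈ Icc (0 : ℝ) 1) → l g ≤ S) →
      ν univ ≤ ENNReal.ofReal S := by
    intro S hS
    rw [isOpen_univ.measure_eq_iSup_isCompact]
    refine iSup₂_le fun K _ => iSup_le fun hK => ?_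
    obtain ⟨g, hg1, -, hgs, hg⟩ := exists_continuous_one_zero_of_isCompact hK isClosed_empty
      (disjoint_empty K)
    let G : C_c(X, ℝ) := ⟨g, hgs⟩
    refine (RealRMK.rieszMeasure_le_of_eq_one L (f := G) (fun x => (hg x).1) hK
      fun x hx => hg1 hx).trans ?_
    exact ENNReal.ofReal_le_ofReal (hS G hg)
  have hfin : IsFiniteMeasure ν := ⟨(hν S₀ hS₀).trans_lt ENNReal.ofReal_lt_top⟩
  refine ⟨ν, hfin, fun g => (RealRMK.integral_rieszMeasure L g).symm, fun S hS => ?_⟩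
  refine ENNReal.toReal_le_of_le_ofReal ?_ (hν S hS)
  simpa using hS 0 (by simp)

end Representation

/-! ### Duality for test functions with bounded values and gradients -/

section PosSup

variable {X : Type*} [TopologicalSpace X]

/-- The supremum of the positive part of a compactly supported function; it is zero on the empty
space. -/
def posSup (g : C_c(X, ℝ)) : ℝ := ⨆ x, max (g x) 0

lemma posSup_nonneg (g : C_c(X, ℝ)) : 0 ≤ posSup g := Real.iSup_nonneg fun _ => le_max_right _ _

lemma le_posSup (g : C_c(X, ℝ)) (x : X) : g x ≤ posSup g := by
  have hb : BddAbove (range fun x => max (g x) 0) := by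
    obtain ⟨C, hC⟩ := g.continuous.bounded_above_of_compact_support g.hasCompactSupport
    refine ⟨C, ?_⟩
    rintro _ ⟨y, rfl⟩
    have := hC y
    exact max_le ((le_abs_self _).trans this) ((norm_nonneg _).trans this)
  exact (le_max_left _ _).trans (le_ciSup hb x)

lemma posSup_le {g : C_c(X, ℝ)} {t : ℝ} (ht : 0 ≤ t) (h : ∀ x, g x ≤ t) : posSup g ≤ t :=
  Real.iSup_le (fun x => max_le (h x) ht) ht

lemma posSup_add_le (g h : C_c(X, ℝ)) : posSup (g + h) ≤ posSup g + posSup h :=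
  posSup_le (add_nonneg (posSup_nonneg g) (posSup_nonneg h)) fun x =>
    add_le_add (le_posSup g x) (le_posSup h x)

lemma posSup_smul {c : ℝ} (hc : 0 < c) (g : C_c(X, ℝ)) : posSup (c • g) = c * posSup g := by
  have key : ∀ {c : ℝ}, 0 < c → ∀ g : C_c(X, ℝ), posSup (c • g) ≤ c * posSup g := fun hc g =>
    posSup_le (mul_nonneg hc.le (posSup_nonneg g)) fun x =>
      mul_le_mul_of_nonneg_left (le_posSup g x) hc.le
  refine le_antisymm (key hc g) ?_
  have h1 := key (inv_pos.2 hc) (c • g)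
  rw [smul_smul, inv_mul_cancel₀ hc.ne', one_smul] at h1
  rwa [inv_mul_eq_div, le_div_iff₀ hc, mul_comm] at h1

end PosSup

section Duality

variable {m : ℕ} {U : Opens (Eu m)}

/-- The Hahn–Banach step: a linear functional that is at most `c` on the test functions with values
in `[-A, B]` and gradient of norm at most `M` splits along `φ ↦ (φ, -φ, ∇φ)`. -/
lemma exists_linear_splitting {A B M c : ℝ} (hA : 0 < A) (hB : 0 < B) (hM : 0 < M)
    (L : 𝓓(U, ℝ) →ₗ[ℝ] ℝ)
    (hL : ∀ φ : 𝓓(U, ℝ), (∀ x : U, φ (x : Eu m) ∈ Icc (-A) B) → ‖gradLp φ‖ ≤ M → L φ ≤ c) :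
    ∃ (l₁ l₂ : C_c(U, ℝ) →ₗ[ℝ] ℝ) (l₃ : LpField U 1 →ₗ[ℝ] ℝ),
      (∀ φ, L φ = l₁ (testCc φ) - l₂ (testCc φ) + l₃ (gradLp φ)) ∧
      ∀ (g₁ g₂ : C_c(U, ℝ)) (v : LpField U 1) (t : ℝ), 0 ≤ t → (∀ x, g₁ x ≤ t * B) →
        (∀ x, g₂ x ≤ t * A) → ‖v‖ ≤ t * M → l₁ g₁ + l₂ g₂ + l₃ v ≤ c * t := by
  -- the functional on the range of `φ ↦ (φ, -φ, ∇φ)` is dominated by the sublinear function `N`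
  have hc : 0 ≤ c := by
    have := hL 0 (fun x => ⟨by simpa using hA.le, by simpa using hB.le⟩) (by simpa using hM.le)
    simpa using this
  let j : 𝓓(U, ℝ) →ₗ[ℝ] C_c(U, ℝ) × C_c(U, ℝ) × LpField U 1 :=
    testCc.prod ((-testCc).prod gradLp)
  have hj : Function.Injective j := fun φ ψ h => testCc_injective (congrArg Prod.fst h)
  let L' : (C_c(U, ℝ) × C_c(U, ℝ) × LpField U 1) →ₗ.[ℝ] ℝ :=
    ⟨LinearMap.range j, L.comp (LinearEquiv.ofInjective j hj).symm.toLinearMap⟩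
  let N : C_c(U, ℝ) × C_c(U, ℝ) × LpField U 1 → ℝ := fun z =>
    c * max (max (posSup z.1 / B) (posSup z.2.1 / A)) (‖z.2.2‖ / M)
  -- `N` is at most `c * t` as soon as the three components are
  have hN : ∀ z t, 0 ≤ t → (∀ x, z.1 x ≤ t * B) → (∀ x, z.2.1 x ≤ t * A) → ‖z.2.2‖ ≤ t * M →
      N z ≤ c * t := by
    intro z t ht h1 h2 h3
    refine mul_le_mul_of_nonneg_left (max_le (max_le ?_ ?_) ?_) hc
    · exact (div_le_iff₀ hB).2 (posSup_le (by positivity) h1)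
    · exact (div_le_iff₀ hA).2 (posSup_le (by positivity) h2)
    · exact (div_le_iff₀ hM).2 h3
  have hLN : ∀ φ, L φ ≤ N (j φ) := by
    intro φ
    let s : ℝ := max (max (posSup (testCc φ) / B) (posSup (-testCc φ) / A)) (‖gradLp φ‖ / M)
    have hs : N (j φ) = c * s := rfl
    have hs0 : 0 ≤ s := le_max_of_le_right (by positivity)
    have h1 : posSup (testCc φ) ≤ s * B :=
      (div_le_iff₀ hB).1 ((le_max_left _ _).trans (le_max_left _ _))
    have h2 : posSup (-testCc φ) ≤ s * A :=
      (div_le_iff₀ hA).1 ((le_max_right _ _).trans (le_max_left _ _))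
    have h3 : ‖gradLp φ‖ ≤ s * M := (div_le_iff₀ hM).1 (le_max_right _ _)
    have h1' : ∀ x : U, φ (x : Eu m) ≤ s * B := fun x => (le_posSup (testCc φ) x).trans h1
    have h2' : ∀ x : U, -φ (x : Eu m) ≤ s * A := fun x => (le_posSup (-testCc φ) x).trans h2
    rw [hs]
    rcases hs0.eq_or_lt with h0 | hpos
    · have : φ = 0 := testCc_injective (by
        ext x
        have a1 := h1' x
        have a2 := h2' x
        rw [← h0, zero_mul] at a1 a2
        rw [map_zero]
        exact le_antisymm a1 (by simpa using a2))
      simp [this, ← h0]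
    · have := hL (s⁻¹ • φ) (fun x => ?_) ?_
      · rw [map_smul, smul_eq_mul, inv_mul_le_iff₀ hpos] at this
        linarith
      · have a1 := h1' x
        have a2 := h2' x
        change s⁻¹ * φ (x : Eu m) ∈ Icc (-A) B
        refine ⟨?_, (inv_mul_le_iff₀ hpos).2 a1⟩
        rw [le_inv_mul_iff₀ hpos]
        linarith
      · rw [map_smul, norm_smul, norm_inv, Real.norm_of_nonneg hs0]
        exact (inv_mul_le_iff₀ hpos).2 h3
  have hfac : ∀ {a b c k : ℝ}, 0 < k → max (max (k * a) (k * b)) (k * c) =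
      k * max (max a b) c := fun hk => by
    rw [mul_max_of_nonneg _ _ hk.le, mul_max_of_nonneg _ _ hk.le]
  obtain ⟨l, hlL, hlN⟩ := exists_extension_of_le_sublinear L' N
    (fun k hk z => by
      change c * max (max (posSup (k • z.1) / B) (posSup (k • z.2.1) / A)) (‖k • z.2.2‖ / M) = _
      rw [posSup_smul hk, posSup_smul hk, norm_smul, Real.norm_of_nonneg hk.le, mul_div_assoc,
        mul_div_assoc, mul_div_assoc, hfac hk]
      ring)
    (fun z w => by
      rw [← mul_add]
      refine mul_le_mul_of_nonneg_left (max_le (max_le ?_ ?_) ?_) hc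
      · refine (div_le_div_of_nonneg_right (posSup_add_le z.1 w.1) hB.le).trans ?_
        rw [add_div]
        exact add_le_add ((le_max_left _ _).trans (le_max_left _ _))
          ((le_max_left _ _).trans (le_max_left _ _))
      · refine (div_le_div_of_nonneg_right (posSup_add_le z.2.1 w.2.1) hA.le).trans ?_
        rw [add_div]
        exact add_le_add ((le_max_right _ _).trans (le_max_left _ _))
          ((le_max_right _ _).trans (le_max_left _ _))
      · refine (div_le_div_of_nonneg_right (norm_add_le z.2.2 w.2.2) hM.le).trans ?_
        rw [add_div]
        exact add_le_add (le_max_right _ _) (le_max_right _ _))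
    (by
      rintro ⟨_, φ, rfl⟩
      refine le_of_eq_of_le (congrArg L ?_) (hLN φ)
      exact (LinearEquiv.symm_apply_eq _).2 (Subtype.ext rfl))
  have hlj : ∀ φ, l (j φ) = L φ := fun φ => by
    refine (hlL ⟨j φ, φ, rfl⟩).trans (congrArg L ?_)
    exact (LinearEquiv.symm_apply_eq _).2 (Subtype.ext rfl)
  have hsplit : ∀ z, l z = l (z.1, 0, 0) + l (0, z.2.1, 0) + l (0, 0, z.2.2) := fun z => by
    rw [← map_add, ← map_add]
    simp
  refine ⟨l.comp (LinearMap.inl ℝ _ _), l.comp ((LinearMap.inr ℝ _ _).comp (LinearMap.inl ℝ _ _)),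
    l.comp ((LinearMap.inr ℝ _ _).comp (LinearMap.inr ℝ _ _)), fun φ => ?_, ?_⟩
  · rw [← hlj, hsplit]
    have : l (0, -testCc φ, 0) = -l (0, testCc φ, 0) := by
      rw [← map_neg l]
      refine congrArg l (Prod.ext ?_ (Prod.ext ?_ ?_))
      · exact neg_zero.symm
      · rfl
      · exact neg_zero.symm
    change l (testCc φ, 0, 0) + l (0, -testCc φ, 0) + l (0, 0, gradLp φ) = _
    rw [this]
    rfl
  · intro g₁ g₂ v t ht h1 h2 h3
    refine le_of_eq_of_le (hsplit (g₁, g₂, v)).symm ((hlN _).trans (hN _ t ht h1 h2 h3))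

/-- The dual description of a bound on test functions with values in `[-A, B]` and gradient of norm
at most `M`. -/
theorem exists_dual_representation {A B M c : ℝ} (hA : 0 < A) (hB : 0 < B) (hM : 0 < M)
    (L : 𝓓(U, ℝ) →ₗ[ℝ] ℝ)
    (hL : ∀ φ : 𝓓(U, ℝ), (∀ x : U, φ (x : Eu m) ∈ Icc (-A) B) → ‖gradLp φ‖ ≤ M → L φ ≤ c) :
    ∃ (p n : Measure U) (_ : IsFiniteMeasure p) (_ : IsFiniteMeasure n) (w : LpField U ∞),
      (∀ φ : 𝓓(U, ℝ), L φ = ∫ x, φ (x : Eu m) ∂p - ∫ x, φ (x : Eu m) ∂n +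
        pairing (gradLp φ) w) ∧
      B * p.real univ + A * n.real univ + M * ‖w‖ ≤ c := by
  have hlc : LocallyCompactSpace U := U.isOpen.locallyCompactSpace
  obtain ⟨l₁, l₂, l₃, hsplit, hl⟩ := exists_linear_splitting hA hB hM L hL
  have hc : 0 ≤ c := by
    have := hl 0 0 0 1 zero_le_one (fun x => by simpa using hB.le)
      (fun x => by simpa using hA.le) (by simpa using hM.le)
    simpa using this
  -- multiples of negative functions are admissible with `t = 0`, hence `l₁` and `l₂` are positive
  have hpos₁ : ∀ g : C_c(U, ℝ), 0 ≤ g → 0 ≤ l₁ g := fun g hg => by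
    have := hl (-g) 0 0 0 le_rfl (fun x => by simpa using hg x) (by simp) (by simp)
    simpa using this
  have hpos₂ : ∀ g : C_c(U, ℝ), 0 ≤ g → 0 ≤ l₂ g := fun g hg => by
    have := hl 0 (-g) 0 0 le_rfl (by simp) (fun x => by simpa using hg x) (by simp)
    simpa using this
  -- the joint bound on the unit balls of the three factors
  have hjoint : ∀ (g₁ g₂ : C_c(U, ℝ)) (v : LpField U 1), (∀ x, g₁ x ∈ Icc (0 : ℝ) 1) →
      (∀ x, g₂ x ∈ Icc (0 : ℝ) 1) → ‖v‖ ≤ 1 → B * l₁ g₁ + A * l₂ g₂ + M * l₃ v ≤ c := by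
    intro g₁ g₂ v h1 h2 h3
    have := hl (B • g₁) (A • g₂) (M • v) 1 zero_le_one
      (fun x => by simpa using mul_le_of_le_one_right hB.le (h1 x).2)
      (fun x => by simpa using mul_le_of_le_one_right hA.le (h2 x).2)
      (by simpa [norm_smul, abs_of_pos hM] using mul_le_of_le_one_right hM.le h3)
    simpa using this
  have h0 : ∀ x : U, (0 : C_c(U, ℝ)) x ∈ Icc (0 : ℝ) 1 := by simp
  have hnorm : ∀ (g₁ g₂ : C_c(U, ℝ)), (∀ x, g₁ x ∈ Icc (0 : ℝ) 1) →
      (∀ x, g₂ x ∈ Icc (0 : ℝ) 1) → ∀ v, ‖l₃ v‖ ≤ (c - B * l₁ g₁ - A * l₂ g₂) / M * ‖v‖ := by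
    intro g₁ g₂ h1 h2
    have key : ∀ v, l₃ v ≤ (c - B * l₁ g₁ - A * l₂ g₂) / M * ‖v‖ := by
      intro v
      rcases (norm_nonneg v).eq_or_lt with hv | hv
      · rw [← hv, norm_eq_zero.1 hv.symm]
        simp
      · have := hjoint g₁ g₂ (‖v‖⁻¹ • v) h1 h2 (by
          rw [norm_smul, norm_inv, norm_norm, inv_mul_cancel₀ hv.ne'])
        rw [map_smul, smul_eq_mul] at this
        have h4 : ‖v‖⁻¹ * l₃ v ≤ (c - B * l₁ g₁ - A * l₂ g₂) / M := by
          rw [le_div_iff₀ hM]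
          linarith
        rw [inv_mul_le_iff₀ hv] at h4
        linarith
    intro v
    refine abs_le.2 ⟨?_, key v⟩
    have := key (-v)
    rw [map_neg, norm_neg] at this
    linarith
  let l : StrongDual ℝ (LpField U 1) := l₃.mkContinuous _ (hnorm 0 0 h0 h0)
  have hlnorm : ∀ (g₁ g₂ : C_c(U, ℝ)), (∀ x, g₁ x ∈ Icc (0 : ℝ) 1) →
      (∀ x, g₂ x ∈ Icc (0 : ℝ) 1) → B * l₁ g₁ + A * l₂ g₂ + M * ‖l‖ ≤ c := by
    intro g₁ g₂ h1 h2
    have hnn : 0 ≤ (c - B * l₁ g₁ - A * l₂ g₂) / M := by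
      have := hjoint g₁ g₂ 0 h1 h2 (by simp)
      rw [map_zero, mul_zero] at this
      exact div_nonneg (by linarith) hM.le
    have := l.opNorm_le_bound hnn (hnorm g₁ g₂ h1 h2)
    rw [le_div_iff₀ hM] at this
    linarith
  have hMl : 0 ≤ M * ‖l‖ := by positivity
  obtain ⟨w, hw, hwl⟩ := exists_field_of_dual l
  obtain ⟨p, hp, hpl, hpS⟩ := exists_finiteMeasure_of_positive l₁ hpos₁ (S₀ := c / B) (by
    intro g hg
    rw [le_div_iff₀ hB]
    have := hlnorm g 0 hg h0
    rw [map_zero, mul_zero] at this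
    linarith)
  obtain ⟨n, hn, hnl, hnS⟩ := exists_finiteMeasure_of_positive l₂ hpos₂ (S₀ := c / A) (by
    intro g hg
    rw [le_div_iff₀ hA]
    have := hlnorm 0 g h0 hg
    rw [map_zero, mul_zero] at this
    linarith)
  refine ⟨p, n, hp, hn, w, fun φ => ?_, ?_⟩
  · rw [hsplit, hpl, hnl, ← hwl]
    rfl
  · have h1 : ∀ g₂ : C_c(U, ℝ), (∀ x, g₂ x ∈ Icc (0 : ℝ) 1) →
        p.real univ ≤ (c - A * l₂ g₂ - M * ‖l‖) / B := fun g₂ h2 => hpS _ fun g₁ h1 => by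
      rw [le_div_iff₀ hB]
      linarith [hlnorm g₁ g₂ h1 h2]
    have h2 : n.real univ ≤ (c - B * p.real univ - M * ‖l‖) / A := hnS _ fun g₂ h2 => by
      have := h1 g₂ h2
      rw [le_div_iff₀ hB] at this
      rw [le_div_iff₀ hA]
      linarith
    rw [le_div_iff₀ hA] at h2
    have := mul_le_mul_of_nonneg_left hw hM.le
    linarith

end Duality

/-! ### Approximation with slightly enlarged values -/

section Approximation

variable {m : ℕ} {U : Opens (Eu m)} {f fbar : U → ℝ} {μbar : StrongDual ℝ (LpField U ∞)}
  {a b M δ : ℝ}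

/-- Joint pairing of a test function with a signed measure and of its gradient with a field. -/
def jointPairing (ν : SignedMeasure U) (u : LpField U ∞) : 𝓓(U, ℝ) →ₗ[ℝ] ℝ where
  toFun φ := ∫ᵛ x, φ (x : Eu m) ∂•ν + pairing (gradLp φ) u
  map_add' φ ψ := by
    have h := VectorMeasure.integral_fun_add (B := ContinuousLinearMap.lsmul ℝ ℝ)
      (integrable_testFunction ν φ) (integrable_testFunction ν ψ)
    rw [map_add, pairing_add_left]
    refine (congrArg (· + _) h).trans ?_
    ring
  map_smul' c φ := by
    have h := VectorMeasure.integral_fun_smul ν (ContinuousLinearMap.lsmul ℝ ℝ) c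
      (fun x : U => φ (x : Eu m))
    rw [map_smul, pairing_smul_left]
    refine (congrArg (· + _) h).trans ?_
    simp only [smul_eq_mul, RingHom.id_apply]
    ring

lemma jointPairing_apply (ν : SignedMeasure U) (u : LpField U ∞) (φ : 𝓓(U, ℝ)) :
    jointPairing ν u φ = ∫ᵛ x, φ (x : Eu m) ∂•ν + pairing (gradLp φ) u := rfl

/-- The bipolar inequality: a joint bound for the test functions with values in `[a - δ, b + δ]`
and gradient of norm at most `M` passes to the pair `(f̄, μ̄)`. By duality the joint pairing with
`(ν, u)` is the pairing with a finite measure `p - n` and a field `w`, hence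
`div (u - w) = ν - (p - n)`, and `μ̄` is known on `u - w`. -/
lemma integral_add_le_of_forall_testFunction (ha : a ≤ 0) (hb : 0 ≤ b) (hM : 0 < M) (hδ : 0 < δ)
    (hfbar : Measurable[suslin U] fbar) (hab : ∀ x, fbar x ∈ Icc a b)
    (hμ : ∀ u ν, HasDiv u ν → μbar u = -∫ᵛ x, fbar x ∂•ν) (hμM : ‖μbar‖ ≤ M)
    (ν : SignedMeasure U) (u : LpField U ∞) {c : ℝ}
    (h : ∀ φ : 𝓓(U, ℝ), (∀ x : U, φ (x : Eu m) ∈ Icc (a - δ) (b + δ)) → ‖gradLp φ‖ ≤ M →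
      jointPairing ν u φ ≤ c) :
    ∫ᵛ x, fbar x ∂•ν + μbar u ≤ c := by
  have hA : 0 < δ - a := by linarith
  have hB : 0 < b + δ := by linarith
  obtain ⟨p, n, hp, hn, w, hrep, hle⟩ := exists_dual_representation hA hB hM (jointPairing ν u)
    (fun φ hφ => h φ (by simpa using hφ))
  have hbd : ∀ x, |fbar x| ≤ b - a := fun x => by
    obtain ⟨h1, h2⟩ := hab x
    exact abs_le.2 ⟨by linarith, by linarith⟩
  have hi : ∀ ν : SignedMeasure U, ν.Integrable fbar := fun ν =>
    integrable_signedMeasure_of_bounded ν (aestronglyMeasurable_of_measurable_suslin hfbar _) hbd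
  have hi' : ∀ (μ : Measure U) [IsFiniteMeasure μ], Integrable fbar μ := fun μ _ =>
    Integrable.of_bound (aestronglyMeasurable_of_measurable_suslin hfbar _) (b - a)
      (ae_of_all _ hbd)
  have hdiv : HasDiv (u - w) (ν - (p.toSignedMeasure - n.toSignedMeasure)) := by
    rw [hasDiv_iff_pairing]
    intro φ
    have hφ := integrable_testFunction (U := U) (φ := φ)
    rw [VectorMeasure.integral_sub_vectorMeasure (hφ _) ((hφ _).sub_vectorMeasure (hφ _)),
      VectorMeasure.integral_sub_vectorMeasure (hφ _) (hφ _),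
      integral_signedMeasure_toSignedMeasure, integral_signedMeasure_toSignedMeasure]
    have h1 := hrep φ
    have h2 : pairing (gradLp φ) (u - w) = pairing (gradLp φ) u - pairing (gradLp φ) w :=
      map_sub (pairingₗ U (gradLp φ)) u w
    rw [jointPairing_apply] at h1
    rw [h2]
    linarith
  have hval := hμ _ _ hdiv
  rw [VectorMeasure.integral_sub_vectorMeasure (hi _) ((hi _).sub_vectorMeasure (hi _)),
    VectorMeasure.integral_sub_vectorMeasure (hi _) (hi _),
    integral_signedMeasure_toSignedMeasure, integral_signedMeasure_toSignedMeasure,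
    map_sub] at hval
  have hpb : ∫ x, fbar x ∂p ≤ (b + δ) * p.real univ := by
    have : ∫ x, fbar x ∂p ≤ ∫ _, b + δ ∂p :=
      integral_mono (hi' p) (integrable_const _) fun x => (hab x).2.trans (by linarith)
    rwa [integral_const, smul_eq_mul, mul_comm] at this
  have hna : -((δ - a) * n.real univ) ≤ ∫ x, fbar x ∂n := by
    have : ∫ _, a - δ ∂n ≤ ∫ x, fbar x ∂n :=
      integral_mono (integrable_const _) (hi' n) fun x => (by linarith : a - δ ≤ a).trans (hab x).1
    rw [integral_const, smul_eq_mul] at this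
    linarith
  have hw : μbar w ≤ M * ‖w‖ := (le_abs_self _).trans ((μbar.le_opNorm w).trans
    (mul_le_mul_of_nonneg_right hμM (norm_nonneg _)))
  linarith

/-- Separation in finite dimensions turns the bipolar inequality into simultaneous approximation of
finitely many values. -/
lemma exists_testFunction_near (ha : a ≤ 0) (hb : 0 ≤ b) (hM : 0 < M) (hδ : 0 < δ)
    (hfbar : Measurable[suslin U] fbar) (hab : ∀ x, fbar x ∈ Icc a b)
    (hμ : ∀ u ν, HasDiv u ν → μbar u = -∫ᵛ x, fbar x ∂•ν) (hμM : ‖μbar‖ ≤ M)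
    (S : Finset (SignedMeasure U × LpField U ∞)) {ε : ℝ} (hε : 0 < ε) :
    ∃ φ : 𝓓(U, ℝ), (∀ x : U, φ (x : Eu m) ∈ Icc (a - δ) (b + δ)) ∧ ‖gradLp φ‖ ≤ M ∧
      ∀ q ∈ S, |jointPairing q.1 q.2 φ - (∫ᵛ x, fbar x ∂•q.1 + μbar q.2)| < ε := by
  classical
  let Λ : 𝓓(U, ℝ) →ₗ[ℝ] (S → ℝ) := LinearMap.pi fun q => jointPairing q.1.1 q.1.2
  let K : Set 𝓓(U, ℝ) :=
    {φ | (∀ x : U, φ (x : Eu m) ∈ Icc (a - δ) (b + δ)) ∧ ‖gradLp φ‖ ≤ M}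
  have hK : Convex ℝ K := by
    intro φ hφ ψ hψ s t hs ht hst
    refine ⟨fun x => convex_Icc (a - δ) (b + δ) (hφ.1 x) (hψ.1 x) hs ht hst, ?_⟩
    have := convex_closedBall (0 : LpField U 1) M (mem_closedBall_zero_iff.2 hφ.2)
      (mem_closedBall_zero_iff.2 hψ.2) hs ht hst
    rw [map_add, map_smul, map_smul]
    exact mem_closedBall_zero_iff.1 this
  let y : S → ℝ := fun q => ∫ᵛ x, fbar x ∂•q.1.1 + μbar q.1.2
  have hy : y ∈ closure (Λ '' K) := by
    by_contra hy
    obtain ⟨g, c, hgc, hcy⟩ := geometric_hahn_banach_closed_point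
      (hK.linear_image Λ).closure isClosed_closure hy
    let e : S → ℝ := fun q => g fun j => if q = j then 1 else 0
    have hg : ∀ z : S → ℝ, g z = ∑ q, z q * e q := fun z => by
      exact g.toLinearMap.pi_apply_eq_sum_univ z
    have hi : ∀ ν : SignedMeasure U, ν.Integrable fbar := fun ν =>
      integrable_signedMeasure_of_bounded ν (C := b - a)
        (aestronglyMeasurable_of_measurable_suslin hfbar _) fun x => by
          obtain ⟨h1, h2⟩ := hab x
          exact abs_le.2 ⟨by linarith, by linarith⟩
    have key := integral_add_le_of_forall_testFunction ha hb hM hδ hfbar hab hμ hμM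
      (∑ q : S, e q • q.1.1) (∑ q : S, e q • q.1.2) (c := c) (fun φ h1 h2 => by
        have h3 := (hgc (Λ φ) (subset_closure ⟨φ, ⟨h1, h2⟩, rfl⟩)).le
        rw [hg] at h3
        have h4 : pairing (gradLp φ) (∑ q : S, e q • q.1.2) =
            ∑ q : S, e q * pairing (gradLp φ) q.1.2 := by
          refine (map_sum (pairingₗ U (gradLp φ)) (fun q : S => e q • q.1.2) Finset.univ).trans ?_
          exact Finset.sum_congr rfl fun q _ => pairing_smul_right _ _ _
        rw [jointPairing_apply, VectorMeasure.integral_finsetSum_vectorMeasure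
          fun q _ => integrable_testFunction _ φ, h4, ← Finset.sum_add_distrib]
        refine le_of_eq_of_le (Finset.sum_congr rfl fun q _ => ?_) h3
        rw [VectorMeasure.integral_smul_vectorMeasure, smul_eq_mul, ← mul_add, mul_comm]
        rfl)
    rw [VectorMeasure.integral_finsetSum_vectorMeasure fun q _ => hi _, map_sum,
      ← Finset.sum_add_distrib] at key
    rw [hg] at hcy
    refine absurd (lt_of_lt_of_le hcy (le_of_eq_of_le (Finset.sum_congr rfl fun q _ => ?_) key))
      (lt_irrefl _)
    rw [VectorMeasure.integral_smul_vectorMeasure, map_smul, smul_eq_mul, smul_eq_mul, ← mul_add,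
      mul_comm]
  obtain ⟨_, ⟨φ, hφ, rfl⟩, hd⟩ := Metric.mem_closure_iff.1 hy ε hε
  refine ⟨φ, hφ.1, hφ.2, fun q hq => ?_⟩
  have := (dist_le_pi_dist y (Λ φ) ⟨q, hq⟩).trans_lt hd
  rw [dist_comm, Real.dist_eq] at this
  exact this

end Approximation

/-! ### Smooth truncation -/

/-- A smooth cutoff for the interval `[a, b]`: it vanishes outside `[a, b]` and equals `1` on
`[a + δ, b - δ]`. -/
def plateau (a b δ t : ℝ) : ℝ :=
  Real.smoothTransition ((t - a) / δ) * Real.smoothTransition ((b - t) / δ)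

section Plateau

variable {a b δ : ℝ}

lemma plateau_contDiff : ContDiff ℝ (⊤ : ℕ∞) (plateau a b δ) :=
  (Real.smoothTransition.contDiff.comp ((contDiff_id.sub contDiff_const).div_const δ)).mul
    (Real.smoothTransition.contDiff.comp ((contDiff_const.sub contDiff_id).div_const δ))

lemma plateau_nonneg (t : ℝ) : 0 ≤ plateau a b δ t :=
  mul_nonneg (Real.smoothTransition.nonneg _) (Real.smoothTransition.nonneg _)

lemma plateau_le_one (t : ℝ) : plateau a b δ t ≤ 1 :=
  mul_le_one₀ (Real.smoothTransition.le_one _) (Real.smoothTransition.nonneg _)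
    (Real.smoothTransition.le_one _)

lemma plateau_eq_zero (hδ : 0 < δ) {t : ℝ} (ht : b ≤ t) : plateau a b δ t = 0 := by
  rw [plateau, Real.smoothTransition.zero_of_nonpos (x := (b - t) / δ), mul_zero]
  exact div_nonpos_of_nonpos_of_nonneg (by linarith) hδ.le

lemma plateau_eq_one (hδ : 0 < δ) {t : ℝ} (h1 : a + δ ≤ t) (h2 : t ≤ b - δ) :
    plateau a b δ t = 1 := by
  rw [plateau, Real.smoothTransition.one_of_one_le, Real.smoothTransition.one_of_one_le, mul_one]
  · rw [le_div_iff₀ hδ]; linarith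
  · rw [le_div_iff₀ hδ]; linarith

lemma plateau_neg (t : ℝ) : plateau a b δ (-t) = plateau (-b) (-a) δ t := by
  rw [plateau, plateau, mul_comm]
  congr 2 <;> ring

/-- The smooth truncation to `[a, b]`: the primitive of `plateau` that vanishes at `0`. -/
def truncation (a b δ s : ℝ) : ℝ := ∫ t in (0 : ℝ)..s, plateau a b δ t

lemma plateau_intervalIntegrable (s t : ℝ) :
    IntervalIntegrable (plateau a b δ) volume s t :=
  plateau_contDiff.continuous.intervalIntegrable _ _

lemma truncation_hasDerivAt (s : ℝ) : HasDerivAt (truncation a b δ) (plateau a b δ s) s :=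
  plateau_contDiff.continuous.integral_hasStrictDerivAt 0 s |>.hasDerivAt

lemma truncation_contDiff : ContDiff ℝ (⊤ : ℕ∞) (truncation a b δ) := by
  rw [contDiff_infty_iff_deriv]
  refine ⟨fun s => (truncation_hasDerivAt s).differentiableAt, ?_⟩
  have : deriv (truncation a b δ) = plateau a b δ := funext fun s => (truncation_hasDerivAt s).deriv
  rw [this]
  exact plateau_contDiff

@[simp] lemma truncation_zero : truncation a b δ 0 = 0 := intervalIntegral.integral_same

lemma truncation_neg (s : ℝ) : truncation a b δ (-s) = -truncation (-b) (-a) δ s := by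
  rw [truncation, truncation, intervalIntegral.integral_symm]
  simp only [← plateau_neg]
  rw [intervalIntegral.integral_comp_neg, neg_zero]

lemma truncation_add {s t : ℝ} :
    truncation a b δ t = truncation a b δ s + ∫ x in s..t, plateau a b δ x :=
  (intervalIntegral.integral_add_adjacent_intervals (plateau_intervalIntegrable _ _)
    (plateau_intervalIntegrable _ _)).symm

lemma truncation_mono : Monotone (truncation a b δ) := fun s t hst => by
  rw [truncation_add (s := s) (t := t)]
  exact le_add_of_nonneg_right (intervalIntegral.integral_nonneg hst fun _ _ => plateau_nonneg _)

lemma truncation_sub_le {s t : ℝ} (hst : s ≤ t) :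
    truncation a b δ t ≤ truncation a b δ s + (t - s) := by
  rw [truncation_add (s := s)]
  gcongr
  have := intervalIntegral.integral_mono_on hst
    (plateau_intervalIntegrable (a := a) (b := b) (δ := δ) s t)
    (intervalIntegrable_const (c := (1 : ℝ))) fun x _ => plateau_le_one x
  simpa using this

/-- The bounds of the truncation on the positive half line. -/
lemma truncation_bounds_of_nonneg (ha : a ≤ 0) (hb : 0 ≤ b) (hδ : 0 < δ) {s : ℝ} (hs : 0 ≤ s) :
    0 ≤ truncation a b δ s ∧ truncation a b δ s ≤ b ∧ truncation a b δ s ≤ s ∧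
      (s ≤ b + δ → s - 3 * δ ≤ truncation a b δ s) := by
  have h0 : 0 ≤ truncation a b δ s := by
    simpa using truncation_mono (a := a) (b := b) (δ := δ) hs
  have hself : ∀ {t : ℝ}, 0 ≤ t → truncation a b δ t ≤ t := fun ht => by
    simpa using truncation_sub_le (a := a) (b := b) (δ := δ) ht
  refine ⟨h0, ?_, hself hs, fun hsb => ?_⟩
  · rcases le_total s b with h | h
    · exact (hself hs).trans h
    · have : ∫ x in b..s, plateau a b δ x = 0 := by
        rw [intervalIntegral.integral_congr (g := fun _ => (0 : ℝ))]
        · simp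
        · intro x hx
          rw [uIcc_of_le h] at hx
          exact plateau_eq_zero hδ hx.1
      rw [truncation_add (s := b), this, add_zero]
      exact hself hb
  · rcases le_total s (3 * δ) with h | h
    · linarith
    · -- the plateau function equals `1` on `[δ, s - 2 δ]`
      have h1 : ∫ x in δ..(s - 2 * δ), plateau a b δ x = s - 3 * δ := by
        rw [intervalIntegral.integral_congr (g := fun _ => (1 : ℝ))]
        · simp only [intervalIntegral.integral_const, smul_eq_mul]
          ring
        · intro x hx
          rw [uIcc_of_le (by linarith)] at hx
          exact plateau_eq_one hδ (by linarith [hx.1]) (by linarith [hx.2])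
      have h2 : 0 ≤ truncation a b δ δ := by
        simpa using truncation_mono (a := a) (b := b) (δ := δ) hδ.le
      have h3 := truncation_mono (a := a) (b := b) (δ := δ) (by linarith : s - 2 * δ ≤ s)
      rw [truncation_add (s := δ), h1] at h3
      linarith

lemma truncation_mem_Icc (ha : a ≤ 0) (hb : 0 ≤ b) (hδ : 0 < δ) (s : ℝ) :
    truncation a b δ s ∈ Icc a b := by
  rcases le_total 0 s with hs | hs
  · obtain ⟨h1, h2, -⟩ := truncation_bounds_of_nonneg ha hb hδ hs
    exact ⟨ha.trans h1, h2⟩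
  · obtain ⟨h1, h2, -⟩ := truncation_bounds_of_nonneg (a := -b) (b := -a) (by linarith)
      (by linarith) hδ (neg_nonneg.2 hs)
    have := truncation_neg (a := a) (b := b) (δ := δ) (-s)
    rw [neg_neg] at this
    rw [this]
    exact ⟨by linarith, by linarith⟩

lemma abs_truncation_sub_le (ha : a ≤ 0) (hb : 0 ≤ b) (hδ : 0 < δ) {s : ℝ}
    (hs : s ∈ Icc (a - δ) (b + δ)) : |s - truncation a b δ s| ≤ 3 * δ := by
  rcases le_total 0 s with h | h
  · obtain ⟨-, -, h3, h4⟩ := truncation_bounds_of_nonneg ha hb hδ h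
    have := h4 hs.2
    exact abs_le.2 ⟨by linarith, by linarith⟩
  · obtain ⟨-, -, h3, h4⟩ := truncation_bounds_of_nonneg (a := -b) (b := -a) (by linarith)
      (by linarith) hδ (neg_nonneg.2 h)
    have h5 := h4 (by linarith [hs.1])
    have := truncation_neg (a := a) (b := b) (δ := δ) (-s)
    rw [neg_neg] at this
    rw [this]
    exact abs_le.2 ⟨by linarith, by linarith⟩

end Plateau

section Truncate

variable {m : ℕ} {U : Opens (Eu m)} {a b δ : ℝ}

/-- Since the truncation has slopes in `[0, 1]`, it splits a test function into two parts whose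
gradients point in the same direction, so that their norms add up. -/
lemma exists_truncated_testFunction (ha : a ≤ 0) (hb : 0 ≤ b) (hδ : 0 < δ) (φ : 𝓓(U, ℝ))
    (hφ : ∀ x : U, φ (x : Eu m) ∈ Icc (a - δ) (b + δ)) :
    ∃ ψ : 𝓓(U, ℝ), (∀ x : U, ψ (x : Eu m) ∈ Icc a b) ∧
      (∀ x : U, |φ (x : Eu m) - ψ (x : Eu m)| ≤ 3 * δ) ∧
      ‖gradLp ψ‖ + ‖gradLp (φ - ψ)‖ = ‖gradLp φ‖ := by
  let T := truncation a b δ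
  have hs : tsupport (fun x => T (φ x)) ⊆ tsupport φ := tsupport_comp_subset truncation_zero φ
  let ψ : 𝓓(U, ℝ) := ⟨fun x => T (φ x), truncation_contDiff.comp φ.contDiff,
    φ.hasCompactSupport.comp_left truncation_zero, hs.trans φ.tsupport_subset⟩
  have hψ : ∀ x, ψ x = T (φ x) := fun _ => rfl
  have hgψ : ∀ x, gradient ψ x = plateau a b δ (φ x) • gradient φ x := by
    intro x
    refine HasGradientAt.gradient ?_
    rw [hasGradientAt_iff_hasFDerivAt, map_smulₛₗ]
    exact (truncation_hasDerivAt (φ x)).comp_hasFDerivAt x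
      (testFunction_hasGradientAt φ x).hasFDerivAt
  have hgd : ∀ x, gradient (φ - ψ : 𝓓(U, ℝ)) x = (1 - plateau a b δ (φ x)) • gradient φ x := by
    intro x
    have : φ - ψ = φ + (-1 : ℝ) • ψ := by
      ext y
      simp [sub_eq_add_neg]
    rw [this, gradient_testFunction_add, gradient_testFunction_smul, hgψ]
    module
  refine ⟨ψ, fun x => truncation_mem_Icc ha hb hδ _,
    fun x => abs_truncation_sub_le ha hb hδ (hφ x), ?_⟩
  rw [norm_gradLp, norm_gradLp, norm_gradLp,
    ← integral_add (integrable_gradient ψ).norm (integrable_gradient (φ - ψ)).norm]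
  refine integral_congr_ae (ae_of_all _ fun x => ?_)
  simp only [hgψ, hgd]
  rw [norm_smul, norm_smul, Real.norm_of_nonneg (plateau_nonneg _),
    Real.norm_of_nonneg (sub_nonneg.2 (plateau_le_one _))]
  ring

end Truncate

/-! ### Approximation with exact values -/

section ExactApproximation

variable {m : ℕ} {U : Opens (Eu m)} {f fbar : U → ℝ} {μbar : StrongDual ℝ (LpField U ∞)}
  {a b : ℝ}

lemma exists_hasDiv_lt (hf : bfNorm f < ∞) (h0 : 0 < bfNorm f) {ε : ℝ} (hε : 0 < ε) :
    ∃ (u : LpField U ∞) (ν : SignedMeasure U), HasDiv u ν ∧ ‖u‖ ≤ 1 ∧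
      (bfNorm f).toReal - ε < ∫ᵛ x, f x ∂•ν := by
  have hlt : ENNReal.ofReal ((bfNorm f).toReal - ε) < bfNorm f := by
    conv_rhs => rw [← ENNReal.ofReal_toReal hf.ne]
    exact (ENNReal.ofReal_lt_ofReal_iff (ENNReal.toReal_pos h0.ne' hf.ne)).2 (by linarith)
  conv_rhs at hlt => rw [bfNorm]
  simp only [lt_iSup_iff] at hlt
  obtain ⟨u, ν, h, hu, hlt⟩ := hlt
  exact ⟨u, ν, h, hu, (ENNReal.ofReal_lt_ofReal_iff').1 hlt |>.1⟩

/-- Test functions with values in `[a, b]` approximate `(f̄, μ̄)`. The functions with values in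
`[a - δ, b + δ]` from `exists_testFunction_near` are truncated; testing with a nearly optimal field
`u₀` shows that this costs almost nothing in the gradient. -/
lemma exists_testFunction_near_of_mem_Icc (ha : a ≤ 0) (hb : 0 ≤ b) (hf : bfNorm f < ∞)
    (h0 : 0 < bfNorm f) (hfbar : Measurable[suslin U] fbar) (hab : ∀ x, fbar x ∈ Icc a b)
    (hff : ∀ u ν, HasDiv u ν → ∫ᵛ x, fbar x ∂•ν = ∫ᵛ x, f x ∂•ν)
    (hμ : ∀ u ν, HasDiv u ν → μbar u = -∫ᵛ x, f x ∂•ν) (hμM : ‖μbar‖ ≤ (bfNorm f).toReal)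
    (S : Finset (SignedMeasure U × LpField U ∞)) {ε : ℝ} (hε : 0 < ε) :
    ∃ ψ : 𝓓(U, ℝ), (∀ x : U, ψ (x : Eu m) ∈ Icc a b) ∧ ‖gradLp ψ‖ ≤ (bfNorm f).toReal ∧
      ∀ q ∈ S, |jointPairing q.1 q.2 ψ - (∫ᵛ x, fbar x ∂•q.1 + μbar q.2)| < ε := by
  classical
  set M := (bfNorm f).toReal
  have hM : 0 < M := ENNReal.toReal_pos h0.ne' hf.ne
  obtain ⟨R, hR⟩ := (S.image fun q => max (q.1.variation.real univ) ‖q.2‖).exists_le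
  have hR1 : ∀ q ∈ S, q.1.variation.real univ ≤ max R 0 := fun q hq => le_max_of_le_left
    ((le_max_left _ _).trans (hR _ (Finset.mem_image_of_mem _ hq)))
  have hR2 : ∀ q ∈ S, ‖q.2‖ ≤ max R 0 := fun q hq => le_max_of_le_left
    ((le_max_right _ _).trans (hR _ (Finset.mem_image_of_mem _ hq)))
  have hR0 : 0 ≤ max R 0 := le_max_right _ _
  generalize max R 0 = R at hR1 hR2 hR0
  -- `φ` approximates up to `η`, and `φ - ψ` is to have integrals of size at most `η` and a gradient
  -- of norm at most `3 * η`, so that its pairings are at most `η + 3 * η * R`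
  let η : ℝ := ε / (4 * R + 3)
  have hη : 0 < η := by positivity
  obtain ⟨u, ν, huν, hu1, hlt⟩ := exists_hasDiv_lt hf h0 hη
  let V : ℝ := ν.variation.real univ
  have hV : 0 ≤ V := measureReal_nonneg
  let δ : ℝ := η / (3 * (R + V + 1))
  have hδ : 0 < δ := by positivity
  have hδ3 : 3 * δ * (R + V + 1) = η := by
    simp only [δ]
    field_simp
  obtain ⟨φ, hφ, hφM, hφS⟩ := exists_testFunction_near ha hb hM hδ hfbar hab
    (fun u ν h => by rw [hμ u ν h, hff u ν h]) hμM (insert (0, -u) S) hη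
  obtain ⟨ψ, hψ, hφψ, hnorm⟩ := exists_truncated_testFunction ha hb hδ φ hφ
  have hψM : ‖gradLp ψ‖ ≤ M := by linarith [norm_nonneg (gradLp (φ - ψ))]
  have hdiff : ∀ ν : SignedMeasure U, |∫ᵛ x, (φ - ψ) (x : Eu m) ∂•ν| ≤
      3 * δ * ν.variation.real univ := fun ν => abs_integral_signedMeasure_le ν hφψ
  have h1 := hφS (0, -u) (Finset.mem_insert_self _ _)
  have hμu : μbar (-u) = ∫ᵛ x, f x ∂•ν := by rw [map_neg, hμ u ν huν, neg_neg]
  rw [jointPairing_apply, VectorMeasure.integral_zero_vectorMeasure,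
    VectorMeasure.integral_zero_vectorMeasure, zero_add, zero_add, hμu] at h1
  have h2 : pairing (gradLp φ) (-u) = pairing (gradLp ψ) (-u) + pairing (gradLp (φ - ψ)) (-u) := by
    rw [← pairing_add_left, ← map_add, add_sub_cancel]
  have h3 : pairing (gradLp (φ - ψ)) (-u) = ∫ᵛ x, (φ - ψ) (x : Eu m) ∂•ν := by
    have := hasDiv_iff_pairing.1 huν (φ - ψ)
    have h4 : pairing (gradLp (φ - ψ)) (-u) = -pairing (gradLp (φ - ψ)) u :=
      map_neg (pairingₗ U (gradLp (φ - ψ))) u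
    rw [h4, this, neg_neg]
  have h4 := hdiff ν
  have h5 : 3 * δ * V ≤ η := by
    have : 0 ≤ δ * R := by positivity
    linarith
  have h6 : |pairing (gradLp ψ) (-u)| ≤ ‖gradLp ψ‖ := by
    refine (abs_pairing_le _ _).trans ?_
    rw [norm_neg]
    exact mul_le_of_le_one_right (norm_nonneg _) hu1
  have h7 : ‖gradLp (φ - ψ)‖ ≤ 3 * η := by
    have a1 := (abs_lt.1 h1).1
    have a2 := (abs_le.1 (h4.trans h5)).2
    have a3 := (le_abs_self _).trans h6
    linarith
  refine ⟨ψ, hψ, hψM, fun q hq => ?_⟩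
  have h8 := hφS q (Finset.mem_insert_of_mem hq)
  have h9 : |jointPairing q.1 q.2 (φ - ψ)| ≤ η + 3 * η * R := by
    rw [jointPairing_apply]
    refine (abs_add_le _ _).trans (add_le_add ((hdiff q.1).trans ?_) ?_)
    · have a1 := mul_le_mul_of_nonneg_left (hR1 q hq) (by positivity : 0 ≤ 3 * δ)
      have a2 : 0 ≤ δ * V := by positivity
      linarith
    · exact (abs_pairing_le _ _).trans (mul_le_mul h7 (hR2 q hq) (norm_nonneg _) (by positivity))
  have h10 : η * (4 * R + 3) = ε := div_mul_cancel₀ _ (by positivity)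
  rw [map_sub] at h9
  rw [abs_lt] at h8 ⊢
  rw [abs_le] at h9
  have h11 : 0 ≤ η * R := by positivity
  constructor <;> linarith [h8.1, h8.2, h9.1, h9.2]

end ExactApproximation

/-! ### The approximating net -/

section Net

variable {m : ℕ} {U : Opens (Eu m)} {f fbar : U → ℝ} {μbar : StrongDual ℝ (LpField U ∞)}
  {a b : ℝ}

/-- A single net of test functions that approximates all joint pairings; it is indexed by the finite
sets of pairs `(ν, u)` and the tolerances `1 / (n + 1)`. -/
lemma exists_net (ha : a ≤ 0) (hb : 0 ≤ b) (hf : bfNorm f < ∞)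
    (h0 : 0 < bfNorm f) (hfbar : Measurable[suslin U] fbar) (hab : ∀ x, fbar x ∈ Icc a b)
    (hff : ∀ u ν, HasDiv u ν → ∫ᵛ x, fbar x ∂•ν = ∫ᵛ x, f x ∂•ν)
    (hμ : ∀ u ν, HasDiv u ν → μbar u = -∫ᵛ x, f x ∂•ν) (hμM : ‖μbar‖ ≤ (bfNorm f).toReal) :
    ∃ ψ : Finset (SignedMeasure U × LpField U ∞) × ℕ → 𝓓(U, ℝ),
      (∀ α, ∀ x : U, ψ α (x : Eu m) ∈ Icc a b) ∧ (∀ α, ‖gradLp (ψ α)‖ ≤ (bfNorm f).toReal) ∧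
      ∀ ν u, Tendsto (fun α => jointPairing ν u (ψ α)) atTop
        (𝓝 (∫ᵛ x, fbar x ∂•ν + μbar u)) := by
  classical
  have key : ∀ α : Finset (SignedMeasure U × LpField U ∞) × ℕ, ∃ ψ : 𝓓(U, ℝ),
      (∀ x : U, ψ (x : Eu m) ∈ Icc a b) ∧ ‖gradLp ψ‖ ≤ (bfNorm f).toReal ∧
      ∀ q ∈ α.1, |jointPairing q.1 q.2 ψ - (∫ᵛ x, fbar x ∂•q.1 + μbar q.2)|
        < 1 / ((α.2 : ℝ) + 1) := fun α =>
    exists_testFunction_near_of_mem_Icc ha hb hf h0 hfbar hab hff hμ hμM α.1 (by positivity)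
  choose ψ h1 h2 h3 using key
  refine ⟨ψ, h1, h2, fun ν u => Metric.tendsto_nhds.2 fun ε hε => ?_⟩
  obtain ⟨n, hn⟩ := exists_nat_one_div_lt hε
  filter_upwards [eventually_ge_atTop (({(ν, u)} : Finset _), n)] with α hα
  rw [Real.dist_eq]
  have hmem : (ν, u) ∈ α.1 := hα.1 (Finset.mem_singleton_self _)
  exact ((h3 α (ν, u) hmem).trans_le (Nat.one_div_le_one_div hα.2)).trans hn

end Net

end BoundedFluctuation

end

theorem mainTheorem2 {m : ℕ} (hm : 1 ≤ m) (U : Opens (BoundedFluctuation.Eu m))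
    (a b : ℝ) (ha : a ≤ 0) (hb : 0 ≤ b)
    (f : U → ℝ) (hf : BoundedFluctuation.IsBF f) (hfab : ∀ x, f x ∈ Icc a b)
    (μbar : StrongDual ℝ (BoundedFluctuation.LpField U ∞)) (fbar : U → ℝ)
    (hext : (μbar, fbar) ∈ BoundedFluctuation.extensions f) :
    BoundedFluctuation.IsGaussFunctional f (BoundedFluctuation.gaussFunctional f) ∧
    ∃ (ι : Type) (_ : Preorder ι) (_ : IsDirectedOrder ι) (_ : Nonempty ι)
      (F : ι → C₀(U, ℝ)) (G : ι → BoundedFluctuation.LpField U 1),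
      -- values in `[a, b]`, integrable gradient, gradient bound
      (∀ α x, F α x ∈ Icc a b) ∧
      (∀ α, BoundedFluctuation.HasGrad (F α) (G α)) ∧
      (∀ α, ‖G α‖ₑ ≤ BoundedFluctuation.bfNorm f) ∧
      -- the net consists of test functions
      (∀ α, ∃ φ : 𝓓(U, ℝ), ∀ x : U, F α x = φ (x : BoundedFluctuation.Eu m)) ∧
      -- weak* convergence to `f̄` in the dual of the finite signed measures; if `‖f‖_BF = 0`, then
      -- all `F α` vanish, so that this is possible for `f̄ = 0` only
      ((BoundedFluctuation.bfNorm f = 0 → fbar = 0) →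
        ∀ ν : SignedMeasure U,
          Tendsto (fun α => ∫ᵛ x, F α x ∂•ν) atTop (𝓝 (∫ᵛ x, fbar x ∂•ν))) ∧
      -- weak* convergence to `f` in the dual of the divergence measures
      (∀ ν ∈ BoundedFluctuation.Mdiv U,
        Tendsto (fun α => ∫ᵛ x, F α x ∂•ν) atTop (𝓝 (∫ᵛ x, f x ∂•ν))) ∧
      -- weak* convergence of the gradients to `μ̄_f` in `L_∞'`
      (∀ u : BoundedFluctuation.LpField U ∞,
        Tendsto (fun α => BoundedFluctuation.pairing (G α) u) atTop (𝓝 (μbar u))) ∧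
      -- weak* convergence of the gradients to `μ_f` in `DB'`
      (∀ u : BoundedFluctuation.DB U,
        Tendsto (fun α => BoundedFluctuation.pairing (G α) u) atTop
          (𝓝 (BoundedFluctuation.gaussFunctional f u))) := by
  classical
  have hC : ∀ x, |f x| ≤ b - a := fun x => by
    obtain ⟨h1, h2⟩ := hfab x
    exact abs_le.2 ⟨by linarith, by linarith⟩
  obtain ⟨hμ, hμn, hmeas, hae, hran⟩ := hext
  have hgauss := BoundedFluctuation.isGaussFunctional_gaussFunctional
    (BoundedFluctuation.exists_isGaussFunctional hm hf.bfNorm_lt_top hmeas hae hC)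
  refine ⟨hgauss, ?_⟩
  have hbarab : ∀ x, fbar x ∈ Icc a b := fun x => by
    obtain ⟨y, hy⟩ := hran ⟨x, rfl⟩
    have hy' : f y = fbar x := hy
    rw [← hy']
    exact hfab y
  have hff : ∀ (u : BoundedFluctuation.LpField U ∞) (ν : SignedMeasure U),
      BoundedFluctuation.HasDiv u ν → ∫ᵛ x, fbar x ∂•ν = ∫ᵛ x, f x ∂•ν := fun u ν h =>
    VectorMeasure.integral_congr_ae (h.ae_eq hm hae)
  have hμdiv : ∀ (u : BoundedFluctuation.LpField U ∞) (ν : SignedMeasure U),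
      BoundedFluctuation.HasDiv u ν → μbar u = -∫ᵛ x, f x ∂•ν := fun u ν h =>
    (hμ ⟨u, BoundedFluctuation.DM_le_DB U ⟨ν, h⟩⟩).trans (hgauss.1 u ν h)
  have hμM : ‖μbar‖ = (BoundedFluctuation.bfNorm f).toReal := by
    rw [← hμn, toReal_enorm]
  rcases eq_zero_or_pos (BoundedFluctuation.bfNorm f) with h0 | h0
  · -- if `‖f‖_BF = 0`, then `μ̄ = 0` and `f` integrates to zero against all divergence measures
    have hμ0 : ∀ u, μbar u = 0 := fun u => by
      rw [h0, ENNReal.toReal_zero, norm_eq_zero] at hμM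
      rw [hμM]
      rfl
    have hp : ∀ u : BoundedFluctuation.LpField U ∞, BoundedFluctuation.pairing 0 u = 0 := fun u =>
      map_zero ((BoundedFluctuation.pairingₗ U).flip u)
    refine ⟨Unit, inferInstance, inferInstance, inferInstance,
      fun _ => BoundedFluctuation.testC0 0, fun _ => BoundedFluctuation.gradLp 0,
      fun _ x => ⟨ha, hb⟩, fun _ => BoundedFluctuation.hasGrad_testC0 0, fun _ => ?_,
      fun _ => ⟨0, fun x => rfl⟩, fun h ν => ?_, ?_, fun u => ?_, fun u => ?_⟩
    · rw [map_zero, enorm_zero]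
      exact zero_le
    · rw [h h0]
      exact tendsto_const_nhds
    · rintro ν ⟨u, h⟩
      have := BoundedFluctuation.abs_integral_le_bfNorm hf.bfNorm_lt_top h
      rw [h0, ENNReal.toReal_zero, zero_mul, abs_nonpos_iff] at this
      rw [this]
      exact tendsto_const_nhds.congr fun _ => (VectorMeasure.integral_zero
        (μ := ν) (B := ContinuousLinearMap.lsmul ℝ ℝ)).symm
    · simp only [map_zero, hp, hμ0]
      exact tendsto_const_nhds
    · have hu : BoundedFluctuation.gaussFunctional f u = 0 := (hμ u).symm.trans (hμ0 u)
      simp only [map_zero, hp, hu]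
      exact tendsto_const_nhds
  · obtain ⟨ψ, h1, h2, h3⟩ := BoundedFluctuation.exists_net ha hb hf.bfNorm_lt_top h0 hmeas hbarab
      hff hμdiv hμM.le
    -- the joint pairings with `(ν, 0)` and with `(0, u)`
    have hν : ∀ ν : SignedMeasure U, Tendsto (fun α => ∫ᵛ x, BoundedFluctuation.testC0 (ψ α) x ∂•ν)
        atTop (𝓝 (∫ᵛ x, fbar x ∂•ν)) := fun ν => by
      have := h3 ν 0
      rw [map_zero, add_zero] at this
      refine this.congr fun α => ?_
      rw [BoundedFluctuation.jointPairing_apply]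
      have hz : BoundedFluctuation.pairing (BoundedFluctuation.gradLp (ψ α)) 0 = 0 :=
        map_zero (BoundedFluctuation.pairingₗ U _)
      rw [hz, add_zero]
      rfl
    have hu : ∀ u : BoundedFluctuation.LpField U ∞, Tendsto
        (fun α => BoundedFluctuation.pairing (BoundedFluctuation.gradLp (ψ α)) u) atTop
        (𝓝 (μbar u)) := fun u => by
      have := h3 0 u
      rw [VectorMeasure.integral_zero_vectorMeasure, zero_add] at this
      refine this.congr fun α => ?_
      rw [BoundedFluctuation.jointPairing_apply, VectorMeasure.integral_zero_vectorMeasure,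
        zero_add]
    refine ⟨Finset (SignedMeasure U × BoundedFluctuation.LpField U ∞) × ℕ, inferInstance,
      inferInstance, inferInstance, fun α => BoundedFluctuation.testC0 (ψ α),
      fun α => BoundedFluctuation.gradLp (ψ α), h1,
      fun α => BoundedFluctuation.hasGrad_testC0 (ψ α), fun α => ?_, fun α => ⟨ψ α, fun _ => rfl⟩,
      fun _ => hν, ?_, hu, fun u => ?_⟩
    · rw [← ofReal_norm]
      exact ENNReal.ofReal_le_of_le_toReal (h2 α)
    · rintro ν ⟨u, h⟩
      rw [← hff u ν h]
      exact hν ν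
    · rw [← hμ u]
      exact hu u
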